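/- **Setting.** Let $K\subset\mathbb R^d$ be a p.c.f. fractal: a nonempty connected compact set with $K=\bigcup_{i=1}^N F_i(K)$, where $|F_i(x)-F_i(y)|=\lambda_i|x-y|$, $0<\lambda_i<1$, whose critical set $\mathcal C=\bigcup_{i\ne j}(F_i(K)\cap F_j(K))$ is nonempty and whose post-critical set $V_0=\{x\in K:\ F_w(x)\in\mathcal C\text{ for some word }w,\ |w|\ge1\}$ is finite ($F_w=F_{w_1}\circ\dots\circ F_{w_n}$). Put $V_{n+1}=\bigcup_iF_i(V_n)$ and $\mathbb T=\mathbb R/\mathbb Z$. Let $K$ carry a regular harmonic structure: symmetric conductances $c^n_{xy}\ge0$ on $V_n$ and numbers $0<r_i<1$ such that the energies $\mathcal E_n(u)=\sum_{x,y\in V_n}c^n_{xy}\tfrac{(u(y)-u(x))^2}{2}$ satisfy $\mathcal E_{n+1}(u)=\sum_i r_i^{-1}\mathcal E_n(u\circ F_i)$ and $\mathcal E_n(u)=\min\{\mathcal E_{n+1}(\bar u):\bar u|_{V_n}=u\}$, and $\mathcal E_0(u)=0$ only for constant $u$. Let $\Gamma_n$ be the graph on $V_n$ with $x\sim_n y$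 iff $x\neq y$ and $c^n_{xy}>0$. The Kuramoto model on $\Gamma_n$ is $$\dot u(t,x)=\sum_{y\in V_n}c^n_{xy}\sin\bigl(2\pi(u(t,y)-u(t,x))\bigr),\qquad x\in V_n,\quad u(t,\cdot):V_n\to\mathbb T .$$ Fix $m\ge0$ and a basis $\gamma_1,\dots,\gamma_b$ of the (real) cycle space of $\Gamma_m$ consisting of simple cycles. Assume that each $\gamma_i$ is extended to a simple cycle $\iota(\gamma_i)$ of $\Gamma_{m+1}$ with $V(\gamma_i)\subset V(\iota(\gamma_i))$, and that $\gamma_i$ is realized by an oriented closed curve in $K$ that runs through $\gamma_i$ (through its vertices in order, the part for each edge staying in an $m$-cell of which it is an edge) and, likewise at level $m+1$, through $\iota(\gamma_i)$. The degree $\omega_{\gamma_i}(f)\in\mathbb Z$ of $f\in C(K,\mathbb T)$ is the increment of a continuous real lift of $f$ along this curve, and $\bar\omega^{(m)}(f)=(\omega_{\gamma_1}(f),\dots,\omega_{\gamma_b}(f))$. Assume that there are cut vertices $\xi_i\in V(\iota(\gamma_i))\subset V_{m+1}$ with $\xi_i\notin V(\iota(\gamma_j))$ for $j\ne i$. The fundamental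 domain $K^0$ is $K$ with each $\xi_i$ replaced by two copies $(\xi_i)_-$, $(\xi_i)_+$: each $(m+1)$-cell containing $\xi_i$ is attached to one of the two copies, in such a way that the curve of $\iota(\gamma_i)$ arrives at $\xi_i$ in a cell attached to $(\xi_i)_+$ and leaves it in a cell attached to $(\xi_i)_-$. Thus $K^0$ is glued from copies $K^0_w$ of the cells $F_w(K)$, $|w|=m+1$. For $n\ge m+1$ the energy of $f$ on $K^0$ at level $n$ is $\mathcal E^0_n(f)=\sum_{|w|=m+1}r_w^{-1}\mathcal E_{n-m-1}(f|_{K^0_w}\circ F_w)$, $r_w=r_{w_1}\cdots r_{w_{m+1}}$. Fix $\rho=(\rho_1,\dots,\rho_b)\in\mathbb Z^b$ and a point $v_1$ of $K^0$ lying over $V_0$. The harmonic map $u^*\in C(K,\mathbb T)$ of degree $\rho$ is the projection mod $1$ of a continuous function $\hat u:K^0\to\mathbb R$ which, for every $n\ge m+1$, minimizes $\mathcal E^0_n$ among the functions $f$ on $K^0$ with $f(v_1)=0$ and $f((\xi_i)_+)=f((\xi_i)_-)+\rho_i$ for all $i$. **Theorem.** For such a $u^*$ one has $\bar\omega^{(m)}(u^*)=\rho$,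 and for every $\varepsilon>0$ there is $n_0$ such that for all $n\ge n_0$ the Kuramoto model on $\Gamma_n$ has a (Lyapunov) stable steady state $u^n:V_n\to\mathbb T$ with $$\max_{x\in V_n}|u^n(x)-u^*(x)|<\varepsilon .$$ Moreover, $u^n$ extends to a continuous function $\tilde u^n:K\to\mathbb T$ with $\bar\omega^{(m)}(\tilde u^n)=\bar\omega^{(m)}(u^*)=\rho$ and $$\max_{x\in K}|\tilde u^n(x)-u^*(x)|<\varepsilon .$$ -/

import Mathlib

open scoped BigOperators

noncomputable section

namespace PCF

/-! ## Post-critically finite self-similar sets -/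

/-- The composition `F_w = F_{w_1} ∘ ... ∘ F_{w_n}` along a word `w` of length `n`. -/
def wordMap {d N : ℕ} (F : Fin N → EuclideanSpace ℝ (Fin d) → EuclideanSpace ℝ (Fin d)) :
    (n : ℕ) → (Fin n → Fin N) → EuclideanSpace ℝ (Fin d) → EuclideanSpace ℝ (Fin d)
  | 0, _ => id
  | n + 1, w => F (w 0) ∘ wordMap F n (fun j => w j.succ)

/-- The critical set `⋃_{i ≠ j} (K_i ∩ K_j)`, where `K_i = F_i(K)`. -/
def criticalSet {d N : ℕ} (F : Fin N → EuclideanSpace ℝ (Fin d) → EuclideanSpace ℝ (Fin d))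
    (K : Set (EuclideanSpace ℝ (Fin d))) : Set (EuclideanSpace ℝ (Fin d)) :=
  {x | ∃ i j, i ≠ j ∧ x ∈ F i '' K ∧ x ∈ F j '' K}

/-- The post-critical set: the points of `K` that some `F_w` with `|w| ≥ 1` sends into the
critical set.  (The preimages are taken for the maps `F_w : K → K`.) -/
def postCriticalSet {d N : ℕ}
    (F : Fin N → EuclideanSpace ℝ (Fin d) → EuclideanSpace ℝ (Fin d))
    (K : Set (EuclideanSpace ℝ (Fin d))) : Set (EuclideanSpace ℝ (Fin d)) :=
  {x | x ∈ K ∧ ∃ (n : ℕ) (w : Fin (n + 1) → Fin N), wordMap F (n + 1) w x ∈ criticalSet F K}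

/-- A p.c.f. fractal in `ℝ^d`: a nonempty, connected, compact set `K = ⋃ F_i(K)`, where the `F_i`
are contracting similarities, with nonempty critical set and finite post-critical set. -/
structure Fractal (d N : ℕ) where
  F : Fin N → EuclideanSpace ℝ (Fin d) → EuclideanSpace ℝ (Fin d)
  ratio : Fin N → ℝ
  ratio_pos : ∀ i, 0 < ratio i
  ratio_lt_one : ∀ i, ratio i < 1
  dist_F : ∀ i x y, dist (F i x) (F i y) = ratio i * dist x y
  K : Set (EuclideanSpace ℝ (Fin d))
  isCompact : IsCompact K
  isConnected : IsConnected K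
  selfSimilar : K = ⋃ i, F i '' K
  critical_nonempty : (criticalSet F K).Nonempty
  finite_postCritical : (postCriticalSet F K).Finite

variable {d N : ℕ}

namespace Fractal

variable (P : Fractal d N)

/-- The `n`-cell map `F_w`, `|w| = n`. -/
def Fw {n : ℕ} (w : Fin n → Fin N) : EuclideanSpace ℝ (Fin d) → EuclideanSpace ℝ (Fin d) :=
  wordMap P.F n w

/-- The vertex sets: `V_0` is the post-critical set and `V_{n+1} = ⋃ F_i(V_n)`. -/
def V : ℕ → Set (EuclideanSpace ℝ (Fin d))
  | 0 => postCriticalSet P.F P.K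
  | n + 1 => ⋃ i, P.F i '' V n

theorem F_mem_K (i : Fin N) {x : EuclideanSpace ℝ (Fin d)} (hx : x ∈ P.K) : P.F i x ∈ P.K := by
  rw [P.selfSimilar]
  exact Set.mem_iUnion.2 ⟨i, x, hx, rfl⟩

theorem Fw_mem_K {n : ℕ} (w : Fin n → Fin N) {x : EuclideanSpace ℝ (Fin d)} (hx : x ∈ P.K) :
    P.Fw w x ∈ P.K := by
  induction n with
  | zero => exact hx
  | succ n ih => exact P.F_mem_K (w 0) (ih (fun j => w j.succ))

theorem F_mem_V (n : ℕ) (i : Fin N) {x : EuclideanSpace ℝ (Fin d)} (hx : x ∈ P.V n) :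
    P.F i x ∈ P.V (n + 1) :=
  Set.mem_iUnion.2 ⟨i, x, hx, rfl⟩

theorem V_subset_K (n : ℕ) : P.V n ⊆ P.K := by
  induction n with
  | zero => exact fun x hx => hx.1
  | succ n ih =>
    intro x hx
    obtain ⟨i, y, hy, rfl⟩ := Set.mem_iUnion.1 hx
    exact P.F_mem_K i (ih hy)

theorem wordMap_snoc (F : Fin N → EuclideanSpace ℝ (Fin d) → EuclideanSpace ℝ (Fin d)) (n : ℕ)
    (w : Fin n → Fin N) (i : Fin N) (y : EuclideanSpace ℝ (Fin d)) :
    wordMap F (n + 1) (Fin.snoc (α := fun _ => Fin N) w i) y = wordMap F n w (F i y) := by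
  induction n with
  | zero => simp [wordMap, Fin.snoc]
  | succ n ih =>
    have h := ih (fun j => w j.succ)
    have h0 : (Fin.snoc (α := fun _ => Fin N) w i : Fin (n + 1 + 1) → Fin N) 0 = w 0 :=
      Fin.snoc_castSucc (α := fun _ => Fin N) i w 0
    have h1 : (fun j : Fin (n + 1) =>
        (Fin.snoc (α := fun _ => Fin N) w i : Fin (n + 1 + 1) → Fin N) j.succ) =
        Fin.snoc (α := fun _ => Fin N) (fun j => w j.succ) i := by
      funext j
      refine Fin.lastCases ?_ (fun k => ?_) j
      · rw [Fin.succ_last, Fin.snoc_last, Fin.snoc_last]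
      · rw [Fin.succ_castSucc, Fin.snoc_castSucc, Fin.snoc_castSucc]
    change F _ (wordMap F (n + 1) _ y) = F (w 0) (wordMap F n (fun j => w j.succ) (F i y))
    rw [h0, h1, h]

theorem V_subset_succ (n : ℕ) : P.V n ⊆ P.V (n + 1) := by
  induction n with
  | zero =>
    rintro x ⟨hx, n, w, hw⟩
    have hx2 := hx
    rw [P.selfSimilar] at hx2
    obtain ⟨i, y, hy, rfl⟩ := Set.mem_iUnion.1 hx2
    refine P.F_mem_V 0 i ⟨hy, n + 1, Fin.snoc (α := fun _ => Fin N) w i, ?_⟩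
    rw [wordMap_snoc]
    exact hw
  | succ n ih =>
    intro x hx
    obtain ⟨i, y, hy, rfl⟩ := Set.mem_iUnion.1 hx
    exact P.F_mem_V (n + 1) i (ih hy)

theorem V_finite (n : ℕ) : (P.V n).Finite := by
  induction n with
  | zero => exact P.finite_postCritical
  | succ n ih => exact Set.finite_iUnion fun i => ih.image _

instance fintypeV (n : ℕ) : Fintype (P.V n) := (P.V_finite n).fintype

/-- A vertex as a point of `K`. -/
def toK {n : ℕ} (x : P.V n) : P.K := ⟨x, P.V_subset_K n x.2⟩

/-- The inclusion `V_n ⊆ V_{n+1}`. -/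
def incl {n : ℕ} (x : P.V n) : P.V (n + 1) := ⟨x, P.V_subset_succ n x.2⟩

/-- The map `F_i : V_n → V_{n+1}`. -/
def mapV {n : ℕ} (i : Fin N) (x : P.V n) : P.V (n + 1) := ⟨P.F i x, P.F_mem_V n i x.2⟩

end Fractal

/-! ## Harmonic structures and the approximating graphs -/

/-- The energy `∑_{x,y} c(x,y) (u(y) - u(x))² / 2` of a function on a finite set. -/
def energy {V : Type*} [Fintype V] (c : V → V → ℝ) (u : V → ℝ) : ℝ :=
  ∑ x, ∑ y, c x y * ((u y - u x) ^ 2 / 2)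

/-- A (regular) harmonic structure on a p.c.f. fractal: conductances `c^n` on the vertex sets
`V_n` and renormalization factors `0 < r_i < 1`, such that the energies are self-similar and
compatible with restriction.  As usual the form on `V_0` vanishes only on constants. -/
structure HarmonicStructure (P : Fractal d N) where
  c : (n : ℕ) → P.V n → P.V n → ℝ
  c_nonneg : ∀ n x y, 0 ≤ c n x y
  c_symm : ∀ n x y, c n x y = c n y x
  r : Fin N → ℝ
  r_pos : ∀ i, 0 < r i
  r_lt_one : ∀ i, r i < 1
  nondegenerate : ∀ u : P.V 0 → ℝ, energy (c 0) u = 0 → ∀ x y, u x = u y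
  selfSimilar : ∀ (n : ℕ) (u : P.V (n + 1) → ℝ),
    energy (c (n + 1)) u = ∑ i, (r i)⁻¹ * energy (c n) (fun x => u (P.mapV i x))
  compatible : ∀ (n : ℕ) (u : P.V n → ℝ),
    IsLeast {e | ∃ v : P.V (n + 1) → ℝ, (∀ x, v (P.incl x) = u x) ∧ e = energy (c (n + 1)) v}
      (energy (c n) u)

namespace HarmonicStructure

variable {P : Fractal d N} (H : HarmonicStructure P)

/-- The graph `Γ_n` on `V_n`: `x ∼ y` iff `c^n(x,y) > 0`. -/
def graph (n : ℕ) : SimpleGraph (P.V n) where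
  Adj x y := x ≠ y ∧ 0 < H.c n x y
  symm := ⟨fun x y h => ⟨h.1.symm, by rw [H.c_symm]; exact h.2⟩⟩
  loopless := ⟨fun _ h => h.1 rfl⟩

end HarmonicStructure

/-! ## The Kuramoto model -/

/-- The function `x ↦ sin(2πx)` on the circle `ℝ/ℤ`. -/
def sinTwoPi (x : UnitAddCircle) : ℝ := (AddCircle.toCircle x : ℂ).im

theorem sinTwoPi_coe (x : ℝ) : sinTwoPi (x : UnitAddCircle) = Real.sin (2 * Real.pi * x) := by
  rw [sinTwoPi, AddCircle.toCircle_apply_mk, Circle.coe_exp]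
  rw [Complex.exp_ofReal_mul_I_im]
  norm_num

namespace HarmonicStructure

variable {P : Fractal d N} (H : HarmonicStructure P)

/-- The right-hand side `∑_y c^n(x,y) sin(2π(u(y) - u(x)))` of the Kuramoto model on `Γ_n`. -/
def kmField (n : ℕ) (u : P.V n → UnitAddCircle) (x : P.V n) : ℝ :=
  ∑ y, H.c n x y * sinTwoPi (u y - u x)

/-- `u : [0,∞) → 𝕋^{V_n}` solves the Kuramoto model.  The time derivative of the `𝕋`-valued
function is that of a real-valued lift. -/
def IsKMSolution (n : ℕ) (u : ℝ → P.V n → UnitAddCircle) : Prop :=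
  ∃ θ : ℝ → P.V n → ℝ, (∀ t, 0 ≤ t → ∀ x, (θ t x : UnitAddCircle) = u t x) ∧
    ∀ t, 0 ≤ t → ∀ x,
      HasDerivWithinAt (fun s => θ s x) (H.kmField n (u t) x) (Set.Ici 0) t

/-- `u` is a (Lyapunov) stable steady state of the Kuramoto model on `Γ_n`. -/
def IsStableSteadyState (n : ℕ) (u : P.V n → UnitAddCircle) : Prop :=
  (∀ x, H.kmField n u x = 0) ∧
    ∀ ε > 0, ∃ δ > 0, ∀ v : ℝ → P.V n → UnitAddCircle, H.IsKMSolution n v →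
      (∀ x, ‖v 0 x - u x‖ < δ) → ∀ t, 0 ≤ t → ∀ x, ‖v t x - u x‖ < ε

end HarmonicStructure

/-! ## Cycles, their curves in `K`, and degrees -/

open Classical in
/-- The 1-chain of a walk: (number of passages `a → b`) minus (number of passages `b → a`). -/
def chain {V : Type*} {G : SimpleGraph V} {x y : V} (p : G.Walk x y) : V → V → ℝ :=
  fun a b => ((p.darts.map fun e => e.toProd).count (a, b) : ℝ) -
    ((p.darts.map fun e => e.toProd).count (b, a) : ℝ)

/-- The cycle space of a finite graph, with real coefficients: antisymmetric functions on
oriented edges with zero divergence at every vertex. -/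
def cycleSpace {V : Type*} [Fintype V] (G : SimpleGraph V) : Submodule ℝ (V → V → ℝ) where
  carrier := {θ | (∀ a b, θ b a = -θ a b) ∧ (∀ a b, ¬ G.Adj a b → θ a b = 0) ∧
    ∀ a, ∑ b, θ a b = 0}
  add_mem' := by
    rintro θ η ⟨h1, h2, h3⟩ ⟨k1, k2, k3⟩
    refine ⟨fun a b => ?_, fun a b hab => ?_, fun a => ?_⟩
    · simp only [Pi.add_apply, h1 a b, k1 a b]; ring
    · simp only [Pi.add_apply, h2 a b hab, k2 a b hab, add_zero]
    · simp only [Pi.add_apply, Finset.sum_add_distrib, h3 a, k3 a, add_zero]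
  zero_mem' := by simp
  smul_mem' := by
    rintro s θ ⟨h1, h2, h3⟩
    refine ⟨fun a b => ?_, fun a b hab => ?_, fun a => ?_⟩
    · simp only [Pi.smul_apply, smul_eq_mul, h1 a b]; ring
    · simp only [Pi.smul_apply, smul_eq_mul, h2 a b hab, mul_zero]
    · simp only [Pi.smul_apply, smul_eq_mul, ← Finset.mul_sum, h3 a, mul_zero]

/-- The continuous map `f : K → 𝕋` has degree `k` along the closed curve `c`: a continuous
real-valued lift of `f ∘ c` increases by `k`. -/
def HasDegree {X : Type*} [TopologicalSpace X] (f : C(X, UnitAddCircle)) {x : X} (c : Path x x)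
    (k : ℤ) : Prop :=
  ∃ h : C(unitInterval, ℝ), (∀ t, (h t : UnitAddCircle) = f (c t)) ∧ h 1 - h 0 = k

namespace HarmonicStructure

variable {P : Fractal d N} (H : HarmonicStructure P)

/-- The closed curve `c` in `K` runs along the closed walk `p` of `Γ_n`: it passes through the
vertices of `p` in order, and its part belonging to the `k`-th edge stays in the `n`-cell with
word `w k`, an `n`-cell `K_{w k}` of which this edge is an edge. -/
def RunsAlong {n : ℕ} {x : P.V n} {a : P.K} (c : Path a a) (p : (H.graph n).Walk x x)
    (w : Fin p.length → Fin n → Fin N) : Prop :=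
  ∃ t : Fin (p.length + 1) → unitInterval, Monotone t ∧ t 0 = 0 ∧ t (Fin.last _) = 1 ∧
    (∀ k, c (t k) = P.toK (p.getVert k)) ∧
    ∀ k : Fin p.length,
      (∀ s ∈ Set.Icc (t k.castSucc) (t k.succ), (c s : EuclideanSpace ℝ (Fin d)) ∈
        P.Fw (w k) '' P.K) ∧
      ∃ y z : P.V 0, 0 < H.c 0 y z ∧
        P.Fw (w k) y = p.getVert k ∧ P.Fw (w k) z = p.getVert (k + 1)

/-- A basis `γ_1, ..., γ_b` of the cycle space of `Γ_m` consisting of cycles, extended to cycles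
`ι(γ_i)` of `Γ_{m+1}`, together with cut vertices `ξ_i`.

`curve i` is `γ_i` regarded as a closed curve in `K`, oriented; it runs along `γ_i` at level `m`
and along `ι(γ_i)` at level `m + 1`.  `word i k` is the `(m+1)`-cell that contains the `k`-th edge
of `ι(γ_i)`.

`side i w` says to which of the two copies of the cut vertex `ξ_i` the `(m+1)`-cell `K_w` (if it
contains `ξ_i`) is attached: `true` for `(ξ_i)_+`, `false` for `(ξ_i)_-`.  The cycle `ι(γ_i)`
is cut open there: it arrives at `ξ_i` in a cell attached to `(ξ_i)_+` and leaves in a cell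
attached to `(ξ_i)_-`. -/
structure CycleBasis (m : ℕ) where
  b : ℕ
  base : Fin b → P.V m
  γ : (i : Fin b) → (H.graph m).Walk (base i) (base i)
  γ_isCycle : ∀ i, (γ i).IsCycle
  linearIndependent : LinearIndependent ℝ fun i => chain (γ i)
  span_eq : Submodule.span ℝ (Set.range fun i => chain (γ i)) = cycleSpace (H.graph m)
  ι : (i : Fin b) → (H.graph (m + 1)).Walk (P.incl (base i)) (P.incl (base i))
  ι_isCycle : ∀ i, (ι i).IsCycle
  extends_γ : ∀ i, ∀ x ∈ (γ i).support, P.incl x ∈ (ι i).support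
  ξ : Fin b → P.V (m + 1)
  ξ_mem : ∀ i, ξ i ∈ (ι i).support
  ξ_notMem : ∀ i j, j ≠ i → ξ i ∉ (ι j).support
  curve : (i : Fin b) → Path (P.toK (base i)) (P.toK (base i))
  curve_γ : ∀ i, ∃ w, H.RunsAlong (curve i) (γ i) w
  word : (i : Fin b) → Fin (ι i).length → Fin (m + 1) → Fin N
  curve_ι : ∀ i, H.RunsAlong (curve i) (ι i) (word i)
  side : Fin b → (Fin (m + 1) → Fin N) → Bool
  arrives : ∀ i (k : Fin (ι i).length), (ι i).getVert (k + 1) = ξ i → side i (word i k) = true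
  leaves : ∀ i (k : Fin (ι i).length), (ι i).getVert k = ξ i → side i (word i k) = false

end HarmonicStructure

/-! ## The fundamental domain and harmonic maps to the circle -/

namespace HarmonicStructure.CycleBasis

variable {P : Fractal d N} {H : HarmonicStructure P} {m : ℕ} (B : H.CycleBasis m)

/-- The points of the fundamental domain `K^0`: the set `K` in which each cut vertex `ξ_i` is
replaced by two copies (`plus i = false` for `(ξ_i)_-` and `plus i = true` for `(ξ_i)_+`). -/
@[ext] structure FundDomain where
  pt : P.K
  plus : Fin B.b → Bool
  plus_eq : ∀ i, (pt : EuclideanSpace ℝ (Fin d)) ≠ B.ξ i → plus i = false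

/-- The copy `(ξ_i)_-` of the cut vertex `ξ_i`. -/
def zMinus (i : Fin B.b) : B.FundDomain := ⟨P.toK (B.ξ i), fun _ => false, fun _ _ => rfl⟩

/-- The copy `(ξ_i)_+` of the cut vertex `ξ_i`. -/
def zPlus (i : Fin B.b) : B.FundDomain :=
  ⟨P.toK (B.ξ i), fun j => decide (j = i), fun j hj => by
    refine decide_eq_false fun h => hj ?_
    rw [h]
    rfl⟩

open Classical in
/-- The `(m+1)`-cell `K^0_w` of the fundamental domain, parametrized by `K` through `F_w`. -/
def cell (w : Fin (m + 1) → Fin N) (x : P.K) : B.FundDomain where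
  pt := ⟨P.Fw w x, P.Fw_mem_K w x.2⟩
  plus i := if P.Fw w x = B.ξ i then B.side i w else false
  plus_eq _ hi := if_neg hi

/-- The fundamental domain is glued from its `(m+1)`-cells, each of which is a copy of `K`. -/
instance : TopologicalSpace B.FundDomain :=
  ⨆ w : Fin (m + 1) → Fin N, TopologicalSpace.coinduced (B.cell w) inferInstance

/-- The Dirichlet energy of level `n = m + 1 + k` on the fundamental domain.  On `K` itself the
energy of level `n` is `∑_{|w| = m+1} r_w⁻¹ 𝓔_k(u ∘ F_w)` by self-similarity; here the cell `K_w`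
is replaced by the cell `K^0_w`, so that every edge at a cut vertex ends at the copy of the
cut vertex to which its cell is attached. -/
def cutEnergy (k : ℕ) (f : B.FundDomain → ℝ) : ℝ :=
  ∑ w : Fin (m + 1) → Fin N,
    (∏ j, H.r (w j))⁻¹ * energy (H.c k) (fun x => f (B.cell w (P.toK x)))

/-- The functions on the fundamental domain that vanish at the reference vertex `v₁` and have the
jumps `ρ_i` at the cut vertices. -/
def Admissible (ρ : Fin B.b → ℤ) (v₁ : B.FundDomain) (f : B.FundDomain → ℝ) : Prop :=
  f v₁ = 0 ∧ ∀ i, f (B.zPlus i) = f (B.zMinus i) + ρ i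

/-- `u : K → 𝕋` is the harmonic map constructed from the degree `ρ`: the projection to `𝕋` of a
continuous function on the fundamental domain that minimizes the Dirichlet energy of every level
`n = m + 1 + k` among the admissible functions. -/
def IsHarmonicMap (ρ : Fin B.b → ℤ) (v₁ : B.FundDomain) (u : C(P.K, UnitAddCircle)) : Prop :=
  ∃ f : B.FundDomain → ℝ, Continuous f ∧ B.Admissible ρ v₁ f ∧
    (∀ (k : ℕ) (g : B.FundDomain → ℝ), B.Admissible ρ v₁ g → B.cutEnergy k f ≤ B.cutEnergy k g) ∧
    ∀ p : B.FundDomain, u p.pt = (f p : UnitAddCircle)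

/-- The degree of `f : K → 𝕋` with respect to the cycle basis is `ρ`. -/
def HasDegreeVector (f : C(P.K, UnitAddCircle)) (ρ : Fin B.b → ℤ) : Prop :=
  ∀ i, HasDegree f (B.curve i) (ρ i)

end HarmonicStructure.CycleBasis

end PCF

end

open scoped BigOperators

noncomputable section

namespace PCF

variable {d N : ℕ}

/-! ### Quadratic energies on a finite set. -/

section FiniteEnergy

variable {V : Type*} [Fintype V]

/-! The degree of the harmonic map is read off its function `f` on the fundamental domain. Inside a
cell a lift of the map differs from `f` by a constant, so along `ι(γ_i)` the increments telescope,
except for the jump `ρ_i` at the single arrival at `ξ_i` (`hasDegreeVector_of_isHarmonicMap`).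

The steady state minimizes the Kuramoto energy of `f + h` over functions `h` on `V_n` of Dirichlet
energy at most one. Since `f` is a minimizer, it is orthogonal to functions on `K`, whence E(f + h)
= E(f) + E(h) (`cutEnergy_add_of_minimal`); moreover E(f) is bounded independently of the level
(`cutEnergy_le_zero`). Conductances of edges grow geometrically (`exists_le_pow_mul_c`), so bounded
energy forces every edge increment below a small η once n is large. For such increments the Kuramoto
energy Φ lies between (1 - 5η²)E and E, and comparing h with 0 gives (1 - 5η²)(E(f) + E(h)) ≤ Φ(f +
h) ≤ Φ(f) ≤ E(f), so E(h) = O(η²). Thus the minimizer is interior to the constraint, hence a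
critical point, and the resistance bound |h(x) - h(y)|² ≤ A E(h), uniform in the level
(`exists_sq_sub_le_levelEnergy`), makes h uniformly small.

Stability also follows from short edges: sine is increasing on the relevant range, so the flow does
not increase the ℓ²-distance to the steady state. Finally h extends to a small real-valued function
on `K`, and adding such a function does not change degrees. -/

theorem energy_nonneg {c : V → V → ℝ} (hc : ∀ x y, 0 ≤ c x y) (u : V → ℝ) : 0 ≤ energy c u :=
  Finset.sum_nonneg fun x _ => Finset.sum_nonneg fun y _ => mul_nonneg (hc x y) (by positivity)

theorem energy_single_le {c : V → V → ℝ} (hc : ∀ x y, 0 ≤ c x y) (u : V → ℝ) (x y : V) :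
    c x y * ((u y - u x) ^ 2 / 2) ≤ energy c u := by
  have h0 : ∀ a b, 0 ≤ c a b * ((u b - u a) ^ 2 / 2) := fun a b =>
    mul_nonneg (hc a b) (by positivity)
  refine (Finset.single_le_sum (fun b _ => h0 x b) (Finset.mem_univ y)).trans ?_
  exact Finset.single_le_sum (f := fun a => ∑ b, c a b * ((u b - u a) ^ 2 / 2))
    (fun a _ => Finset.sum_nonneg fun b _ => h0 a b) (Finset.mem_univ x)

theorem energy_smul (c : V → V → ℝ) (s : ℝ) (u : V → ℝ) :
    energy c (fun x => s * u x) = s ^ 2 * energy c u := by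
  simp only [energy, Finset.mul_sum]
  exact Finset.sum_congr rfl fun x _ => Finset.sum_congr rfl fun y _ => by ring

theorem continuous_energy (c : V → V → ℝ) : Continuous (energy c) := by
  unfold energy
  fun_prop

/-- The symmetric bilinear form `∑ c(x,y) (u(y) - u(x)) (v(y) - v(x))`. -/
def energyPolar (c : V → V → ℝ) (u v : V → ℝ) : ℝ :=
  ∑ x, ∑ y, c x y * ((u y - u x) * (v y - v x))

theorem energy_add (c : V → V → ℝ) (u v : V → ℝ) :
    energy c (fun x => u x + v x) = energy c u + energyPolar c u v + energy c v := by
  simp only [energy, energyPolar, ← Finset.sum_add_distrib]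
  exact Finset.sum_congr rfl fun x _ => Finset.sum_congr rfl fun y _ => by ring

/-- Only the ordered pairs (x, y) and (y, x) contribute, each with factor -1; polarization thus
isolates one conductance. -/
theorem energyPolar_indicator [DecidableEq V] {c : V → V → ℝ} (hs : ∀ x y, c x y = c y x)
    {x y : V} (hxy : x ≠ y) :
    energyPolar c (Pi.single x 1) (Pi.single y 1) = -2 * c x y := by
  have key : ∀ a b : V, c a b * (((Pi.single x 1 : V → ℝ) b - (Pi.single x 1 : V → ℝ) a) *
      ((Pi.single y 1 : V → ℝ) b - (Pi.single y 1 : V → ℝ) a)) =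
      -(if b = x then if a = y then c a b else 0 else 0)
        - (if a = x then if b = y then c a b else 0 else 0) := by
    intro a b
    simp only [Pi.single_apply]
    split_ifs <;> simp_all
  simp only [energyPolar, key, Finset.sum_sub_distrib, Finset.sum_neg_distrib]
  simp
  rw [hs y x]
  ring

/-- The off-diagonal conductances are determined by the energy. -/
theorem eq_of_energy_eq {c c' : V → V → ℝ} (hs : ∀ x y, c x y = c y x)
    (hs' : ∀ x y, c' x y = c' y x) (h : ∀ u, energy c u = energy c' u) {x y : V} (hxy : x ≠ y) :
    c x y = c' x y := by
  classical
  have h1 := energyPolar_indicator hs hxy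
  have h2 := energyPolar_indicator hs' hxy
  have h3 := energy_add c (Pi.single x 1) (Pi.single y 1)
  have h4 := energy_add c' (Pi.single x 1) (Pi.single y 1)
  rw [h, h, h] at h3
  linarith

/-- Poincaré inequality for an energy that vanishes on constants only. -/
theorem exists_sq_sub_le_energy {c : V → V → ℝ} (hc : ∀ x y, 0 ≤ c x y)
    (h0 : ∀ u : V → ℝ, energy c u = 0 → ∀ x y, u x = u y) :
    ∃ C, 0 ≤ C ∧ ∀ (u : V → ℝ) (x y : V), (u x - u y) ^ 2 ≤ C * energy c u := by
  classical
  rcases isEmpty_or_nonempty V with hV | ⟨⟨o⟩⟩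
  · exact ⟨0, le_rfl, fun u x => isEmptyElim x⟩
  -- Fixing the value at `o` removes the constants, so the energy is positive on this compact set
  -- and bounded below there. The set is empty when `V` is a single point.
  let S : Set (V → ℝ) := Metric.sphere 0 1 ∩ {u | u o = 0}
  have hS : IsCompact S :=
    (isCompact_sphere _ _).inter_right (isClosed_eq (continuous_apply o) continuous_const)
  have hpos : ∀ u ∈ S, 0 < energy c u := by
    rintro u ⟨hu1, hu2⟩
    refine lt_of_le_of_ne (energy_nonneg hc u) fun he => ?_
    have hz : u = 0 := funext fun x => by rw [h0 u he.symm x o, hu2]; rfl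
    simp [hz] at hu1
  obtain ⟨μ, hμ, hμS⟩ : ∃ μ > 0, ∀ u ∈ S, μ ≤ energy c u := by
    rcases S.eq_empty_or_nonempty with hE | hE
    · exact ⟨1, one_pos, by simp [hE]⟩
    · obtain ⟨u, hu, hm⟩ := hS.exists_isMinOn hE (continuous_energy c).continuousOn
      exact ⟨_, hpos u hu, fun v hv => hm hv⟩
  have key : ∀ v : V → ℝ, v o = 0 → ‖v‖ ^ 2 ≤ μ⁻¹ * energy c v := by
    intro v hv
    by_cases hv0 : v = 0
    · simpa [hv0] using mul_nonneg (inv_nonneg.2 hμ.le) (energy_nonneg hc 0)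
    have hn : 0 < ‖v‖ := norm_pos_iff.2 hv0
    have := hμS (fun x => ‖v‖⁻¹ * v x) ⟨by
      have : (fun x => ‖v‖⁻¹ * v x) = ‖v‖⁻¹ • v := rfl
      rw [this, mem_sphere_zero_iff_norm, norm_smul, norm_inv, norm_norm]
      exact inv_mul_cancel₀ hn.ne', by simp [hv]⟩
    rw [energy_smul, inv_pow, ← div_eq_inv_mul, le_div_iff₀ (by positivity)] at this
    rw [← div_eq_inv_mul, le_div_iff₀ hμ]
    linarith
  refine ⟨4 * μ⁻¹, by positivity, fun u x y => ?_⟩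
  have h1 := key (fun x => u x - u o) (sub_self _)
  have h2 : energy c (fun x => u x - u o) = energy c u := by simp [energy]
  rw [h2] at h1
  have hx := norm_le_pi_norm (fun x => u x - u o) x
  have hy := norm_le_pi_norm (fun x => u x - u o) y
  rw [Real.norm_eq_abs] at hx hy
  have h3 : |u x - u y| ≤ 2 * ‖fun x => u x - u o‖ := by
    calc |u x - u y| = |(u x - u o) - (u y - u o)| := by ring_nf
      _ ≤ _ := (abs_sub _ _).trans (by linarith)
  calc (u x - u y) ^ 2 = |u x - u y| ^ 2 := (sq_abs _).symm
    _ ≤ (2 * ‖fun x => u x - u o‖) ^ 2 := by gcongr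
    _ ≤ 4 * μ⁻¹ * energy c u := by linarith

end FiniteEnergy

/-! ### Cells, their intersections and their connectedness. -/

namespace Fractal

variable (P : Fractal d N)

theorem F_injective (i : Fin N) : Function.Injective (P.F i) := by
  intro x y h
  have := P.dist_F i x y
  rw [h, dist_self, eq_comm, mul_eq_zero] at this
  exact dist_eq_zero.1 (this.resolve_left (P.ratio_pos i).ne')

theorem continuous_F (i : Fin N) : Continuous (P.F i) :=
  (LipschitzWith.of_dist_le_mul (K := ⟨P.ratio i, (P.ratio_pos i).le⟩)
    fun x y => (P.dist_F i x y).le).continuous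

theorem Fw_succ {n : ℕ} (w : Fin (n + 1) → Fin N) (x : EuclideanSpace ℝ (Fin d)) :
    P.Fw w x = P.F (w 0) (P.Fw (fun j => w j.succ) x) := rfl

theorem Fw_injective {n : ℕ} (w : Fin n → Fin N) : Function.Injective (P.Fw w) := by
  induction n with
  | zero => exact fun _ _ h => h
  | succ n ih => exact fun x y h => ih _ (P.F_injective _ h)

theorem continuous_Fw {n : ℕ} (w : Fin n → Fin N) : Continuous (P.Fw w) := by
  induction n with
  | zero => exact continuous_id
  | succ n ih => exact (P.continuous_F _).comp (ih _)

theorem V_mono {k n : ℕ} (h : k ≤ n) : P.V k ⊆ P.V n :=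
  monotone_nat_of_le_succ (fun n => P.V_subset_succ n) h

/-- Two distinct cells of the same level meet in images of post-critical points only. -/
theorem mem_V_zero_of_Fw_eq {n : ℕ} {w w' : Fin n → Fin N} (hw : w ≠ w')
    {x y : EuclideanSpace ℝ (Fin d)} (hx : x ∈ P.K) (hy : y ∈ P.K) (h : P.Fw w x = P.Fw w' y) :
    x ∈ P.V 0 := by
  induction n with
  | zero => exact absurd (Subsingleton.elim _ _) hw
  | succ n ih =>
    -- A common first letter is cancelled by injectivity; if the first letters differ, the common
    -- point is critical, so x is post-critical by definition.
    by_cases h0 : w 0 = w' 0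
    · refine ih (w := fun j => w j.succ) (w' := fun j => w' j.succ) (fun hE => hw ?_) ?_
      · funext j
        refine Fin.cases h0 (fun j => congrFun hE j) j
      · rw [Fw_succ, Fw_succ, h0] at h
        exact P.F_injective _ h
    · exact ⟨hx, n, w, w 0, w' 0, h0, ⟨_, P.Fw_mem_K _ hx, rfl⟩, ⟨_, P.Fw_mem_K _ hy, h.symm⟩⟩

theorem V_zero_nonempty : (P.V 0).Nonempty := by
  obtain ⟨x, i, j, hij, ⟨y, hy, rfl⟩, hx⟩ := P.critical_nonempty
  exact ⟨y, hy, 0, fun _ => i, i, j, hij, ⟨y, hy, rfl⟩, hx⟩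

/-- The cells of level one form a connected graph: a function on `V_1` that is constant on the
cells is constant. -/
theorem eq_of_const_on_cells {α : Fin N → ℝ}
    (h : ∀ i j, (∃ x ∈ P.V 0, ∃ y ∈ P.V 0, P.F i x = P.F j y) → α i = α j) (i j : Fin N) :
    α i = α j := by
  by_contra hij
  -- Two closed sets covering the connected `K` must meet; a common point lies in two distinct
  -- cells, hence comes from `V_0` in both.
  let A : Set (EuclideanSpace ℝ (Fin d)) := ⋃ l : {l // α l = α i}, P.F l '' P.K
  let B : Set (EuclideanSpace ℝ (Fin d)) := ⋃ l : {l // α l ≠ α i}, P.F l '' P.K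
  have hcl : ∀ l, IsClosed (P.F l '' P.K) := fun l =>
    (P.isCompact.image (P.continuous_F l)).isClosed
  have hA : IsClosed A := isClosed_iUnion_of_finite fun l => hcl l
  have hB : IsClosed B := isClosed_iUnion_of_finite fun l => hcl l
  obtain ⟨z, hz⟩ := P.isConnected.nonempty
  have hcover : P.K ⊆ A ∪ B := by
    intro x hx
    rw [P.selfSimilar] at hx
    obtain ⟨l, hl⟩ := Set.mem_iUnion.1 hx
    by_cases hE : α l = α i
    · exact Or.inl (Set.mem_iUnion.2 ⟨⟨l, hE⟩, hl⟩)
    · exact Or.inr (Set.mem_iUnion.2 ⟨⟨l, hE⟩, hl⟩)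
  obtain ⟨x, -, hxA, hxB⟩ := isPreconnected_closed_iff.1 P.isConnected.isPreconnected A B hA hB
    hcover ⟨P.F i z, P.F_mem_K i hz, Set.mem_iUnion.2 ⟨⟨i, rfl⟩, z, hz, rfl⟩⟩
    ⟨P.F j z, P.F_mem_K j hz, Set.mem_iUnion.2 ⟨⟨j, Ne.symm hij⟩, z, hz, rfl⟩⟩
  obtain ⟨⟨l, hl⟩, y, hy, rfl⟩ := Set.mem_iUnion.1 hxA
  obtain ⟨⟨l', hl'⟩, y', hy', hE⟩ := Set.mem_iUnion.1 hxB
  have hne : l ≠ l' := fun hc => hl' (hc ▸ hl)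
  dsimp only at hE
  refine hl' ((h l' l ⟨y', ?_, y, ?_, hE⟩).trans hl)
  · exact ⟨hy', 0, fun _ => l', l', l, hne.symm, ⟨y', hy', rfl⟩, ⟨y, hy, hE.symm⟩⟩
  · exact ⟨hy, 0, fun _ => l, l, l', hne, ⟨y, hy, rfl⟩, ⟨y', hy', hE⟩⟩

end Fractal

/-! ### Self-similarity and growth of conductances; uniform resistance bound. -/

namespace HarmonicStructure

variable {P : Fractal d N} (H : HarmonicStructure P)

/-- The energy of level `n` of a function on `ℝ^d`. -/
def levelEnergy (n : ℕ) (h : EuclideanSpace ℝ (Fin d) → ℝ) : ℝ :=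
  energy (H.c n) (fun x => h x)

theorem levelEnergy_nonneg (n : ℕ) (h : EuclideanSpace ℝ (Fin d) → ℝ) : 0 ≤ H.levelEnergy n h :=
  energy_nonneg (H.c_nonneg n) _

theorem levelEnergy_succ (n : ℕ) (h : EuclideanSpace ℝ (Fin d) → ℝ) :
    H.levelEnergy (n + 1) h = ∑ i, (H.r i)⁻¹ * H.levelEnergy n (fun x => h (P.F i x)) :=
  H.selfSimilar n _

theorem levelEnergy_mono {k n : ℕ} (hkn : k ≤ n) (h : EuclideanSpace ℝ (Fin d) → ℝ) :
    H.levelEnergy k h ≤ H.levelEnergy n h :=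
  monotone_nat_of_le_succ (f := fun n => H.levelEnergy n h)
    (fun n => (H.compatible n _).2 ⟨_, fun _ => rfl, rfl⟩) hkn

/-- Self-similarity of the conductances. -/
theorem sum_c_succ (n : ℕ) (G : P.V (n + 1) → P.V (n + 1) → ℝ) (hG : ∀ x, G x x = 0) :
    ∑ x, ∑ y, H.c (n + 1) x y * G x y =
      ∑ i, (H.r i)⁻¹ * ∑ a, ∑ b, H.c n a b * G (P.mapV i a) (P.mapV i b) := by
  classical
  -- The push-forward of the cell conductances. It has the same energy as `H.c (n + 1)`, so the two
  -- agree off the diagonal, and `hG` kills the diagonal.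
  let c' : P.V (n + 1) → P.V (n + 1) → ℝ := fun x y => ∑ i, (H.r i)⁻¹ * ∑ a, ∑ b,
    if P.mapV i a = x then if P.mapV i b = y then H.c n a b else 0 else 0
  have hsum : ∀ G : P.V (n + 1) → P.V (n + 1) → ℝ, ∑ x, ∑ y, c' x y * G x y =
      ∑ i, (H.r i)⁻¹ * ∑ a, ∑ b, H.c n a b * G (P.mapV i a) (P.mapV i b) := by
    intro G
    let T : P.V (n + 1) × P.V (n + 1) → Fin N × P.V n × P.V n → ℝ := fun p q =>
      (H.r q.1)⁻¹ * (if P.mapV q.1 q.2.1 = p.1 then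
        if P.mapV q.1 q.2.2 = p.2 then H.c n q.2.1 q.2.2 else 0 else 0) * G p.1 p.2
    calc ∑ x, ∑ y, c' x y * G x y = ∑ p, ∑ q, T p q := by
          simp only [Fintype.sum_prod_type, T, c', Finset.sum_mul, Finset.mul_sum]
      _ = ∑ q, ∑ p, T p q := Finset.sum_comm
      _ = _ := by
          simp [Fintype.sum_prod_type, T, Finset.mul_sum, mul_assoc]
  have hc' : ∀ x y, x ≠ y → H.c (n + 1) x y = c' x y := by
    intro x y hxy
    refine eq_of_energy_eq (H.c_symm _) (fun x y => ?_) (fun u => ?_) hxy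
    · refine Finset.sum_congr rfl fun i _ => ?_
      rw [Finset.sum_comm]
      congr 1
      refine Finset.sum_congr rfl fun a _ => Finset.sum_congr rfl fun b _ => ?_
      rw [H.c_symm]
      split_ifs <;> rfl
    · rw [H.selfSimilar]
      exact (hsum fun x y => (u y - u x) ^ 2 / 2).symm
  rw [← hsum]
  refine Finset.sum_congr rfl fun x _ => Finset.sum_congr rfl fun y _ => ?_
  by_cases hxy : x = y
  · rw [hxy, hG, mul_zero, mul_zero]
  · rw [hc' x y hxy]

/-- A general `G` lets one identity serve the Dirichlet energy, the Kuramoto energy and, with an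
indicator, a single conductance. -/
theorem sum_c_add (k l : ℕ) (G : EuclideanSpace ℝ (Fin d) → EuclideanSpace ℝ (Fin d) → ℝ)
    (hG : ∀ x, G x x = 0) :
    ∑ x : P.V (k + l), ∑ y : P.V (k + l), H.c (k + l) x y * G x y =
      ∑ w : Fin l → Fin N, (∏ j, H.r (w j))⁻¹ *
        ∑ a : P.V k, ∑ b : P.V k, H.c k a b * G (P.Fw w a) (P.Fw w b) := by
  induction l generalizing G with
  | zero =>
    rw [Fintype.sum_unique (ι := Fin 0 → Fin N), Fin.prod_univ_zero, inv_one, one_mul]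
    rfl
  | succ l ih =>
    refine (H.sum_c_succ (k + l) (fun x y => G x y) fun x => hG x).trans ?_
    rw [← (Fin.consEquiv fun _ : Fin (l + 1) => Fin N).sum_comp, Fintype.sum_prod_type]
    refine Finset.sum_congr rfl fun i _ => ?_
    have := ih (fun x y => G (P.F i x) (P.F i y)) fun x => hG _
    refine (congrArg _ this).trans ?_
    rw [Finset.mul_sum]
    refine Finset.sum_congr rfl fun w _ => ?_
    rw [Fin.prod_univ_succ, mul_inv, mul_assoc]
    rfl

theorem levelEnergy_add (k l : ℕ) (h : EuclideanSpace ℝ (Fin d) → ℝ) :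
    H.levelEnergy (k + l) h = ∑ w : Fin l → Fin N, (∏ j, H.r (w j))⁻¹ *
      H.levelEnergy k (fun x => h (P.Fw w x)) :=
  H.sum_c_add k l (fun x y => (h y - h x) ^ 2 / 2) fun x => by simp

/-- By `sum_c_add` for the indicator of (x, y), the conductance is a sum of nonnegative rescaled
cell conductances. A positive sum has a positive term, and each term is at most the sum. -/
theorem exists_Fw_eq_of_c_pos (k l : ℕ) {x y : P.V (k + l)} (hxy : x ≠ y)
    (hc : 0 < H.c (k + l) x y) :
    ∃ (w : Fin l → Fin N) (a b : P.V k), 0 < H.c k a b ∧ P.Fw w a = x ∧ P.Fw w b = y ∧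
      (∏ j, H.r (w j))⁻¹ * H.c k a b ≤ H.c (k + l) x y := by
  classical
  let G : EuclideanSpace ℝ (Fin d) → EuclideanSpace ℝ (Fin d) → ℝ :=
    fun p q => if p = x then if q = y then 1 else 0 else 0
  have hG : ∀ p, G p p = 0 := by
    intro p
    simp only [G]
    split_ifs with h1 h2
    · exact absurd (Subtype.ext (h1.symm.trans h2)) hxy
    · rfl
    · rfl
  have hG0 : ∀ p q, 0 ≤ G p q := fun p q => by simp only [G]; split_ifs <;> norm_num
  have h1 : ∑ p : P.V (k + l), ∑ q : P.V (k + l), H.c (k + l) p q * G p q = H.c (k + l) x y := by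
    simp [G, Subtype.ext_iff.symm]
  have h := H.sum_c_add k l G hG
  rw [h1] at h
  have hr : ∀ w : Fin l → Fin N, 0 < (∏ j, H.r (w j))⁻¹ := fun w =>
    inv_pos.2 (Finset.prod_pos fun j _ => H.r_pos _)
  have ht : ∀ a b p q, 0 ≤ H.c k a b * G p q := fun a b p q =>
    mul_nonneg (H.c_nonneg _ _ _) (hG0 _ _)
  obtain ⟨w, -, hw⟩ : ∃ w ∈ Finset.univ, 0 < (∏ j, H.r (w j))⁻¹ *
        ∑ a : P.V k, ∑ b : P.V k, H.c k a b * G (P.Fw w a) (P.Fw w b) :=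
    Finset.exists_lt_of_sum_lt (f := fun _ => 0) (by rw [← h]; simpa using hc)
  obtain ⟨a, -, ha⟩ : ∃ a ∈ Finset.univ, 0 <
      ∑ b : P.V k, H.c k a b * G (P.Fw w a) (P.Fw w b) :=
    Finset.exists_lt_of_sum_lt (f := fun _ => 0) (by
      simpa using (mul_pos_iff_of_pos_left (hr w)).1 hw)
  obtain ⟨b, -, hb⟩ : ∃ b ∈ Finset.univ, 0 < H.c k a b * G (P.Fw w a) (P.Fw w b) :=
    Finset.exists_lt_of_sum_lt (f := fun _ => 0) (by simpa using ha)
  have hGne : G (P.Fw w a) (P.Fw w b) ≠ 0 := fun h0 => by simp [h0] at hb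
  have hax : P.Fw w a = x := by by_contra h0; simp [G, h0] at hGne
  have hby : P.Fw w b = y := by by_contra h0; simp [G, h0] at hGne
  have hG1 : G (P.Fw w a) (P.Fw w b) = 1 := by simp [G, hax, hby]
  rw [hG1, mul_one] at hb
  refine ⟨w, a, b, hb, hax, hby, ?_⟩
  rw [h]
  refine le_trans ?_ (Finset.single_le_sum (f := fun w : Fin l → Fin N => (∏ j, H.r (w j))⁻¹ *
        ∑ a : P.V k, ∑ b : P.V k, H.c k a b * G (P.Fw w a) (P.Fw w b)) (fun w _ =>
      mul_nonneg (hr w).le (Finset.sum_nonneg fun _ _ => Finset.sum_nonneg fun _ _ => ht _ _ _ _))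
      (Finset.mem_univ w))
  refine mul_le_mul_of_nonneg_left ?_ (hr w).le
  refine le_trans ?_ (Finset.single_le_sum (f := fun a =>
        ∑ b : P.V k, H.c k a b * G (P.Fw w a) (P.Fw w b)) (fun _ _ =>
      Finset.sum_nonneg fun _ _ => ht _ _ _ _) (Finset.mem_univ a))
  refine le_trans ?_ (Finset.single_le_sum (f := fun b =>
        H.c k a b * G (P.Fw w a) (P.Fw w b)) (fun _ _ => ht _ _ _ _) (Finset.mem_univ b))
  rw [hG1, mul_one]

theorem exists_r_le : ∃ q, 0 < q ∧ q < 1 ∧ ∀ i, H.r i ≤ q := by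
  rcases isEmpty_or_nonempty (Fin N) with hN | hN
  · exact ⟨1 / 2, by norm_num, by norm_num, fun i => isEmptyElim i⟩
  · obtain ⟨i, hi⟩ := Finite.exists_max H.r
    exact ⟨H.r i, H.r_pos i, H.r_lt_one i, hi⟩

/-- The conductances of the edges of `Γ_n` grow geometrically in `n`. -/
theorem exists_le_pow_mul_c : ∃ κ q, 0 < κ ∧ 0 < q ∧ q < 1 ∧
    ∀ n (x y : P.V n), x ≠ y → 0 < H.c n x y → κ ≤ q ^ n * H.c n x y := by
  obtain ⟨q, hq0, hq1, hq⟩ := H.exists_r_le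
  obtain ⟨κ, hκ, hmin⟩ : ∃ κ > 0, ∀ x y : P.V 0, 0 < H.c 0 x y → κ ≤ H.c 0 x y := by
    by_cases hne : Nonempty {p : P.V 0 × P.V 0 // 0 < H.c 0 p.1 p.2}
    · obtain ⟨p, hp⟩ := Finite.exists_min
        fun p : {p : P.V 0 × P.V 0 // 0 < H.c 0 p.1 p.2} => H.c 0 p.1.1 p.1.2
      exact ⟨_, p.2, fun x y h => hp ⟨(x, y), h⟩⟩
    · exact ⟨1, one_pos, fun x y h => absurd ⟨⟨(x, y), h⟩⟩ hne⟩
  refine ⟨κ, q, hκ, hq0, hq1, fun n => ?_⟩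
  induction n with
  | zero => exact fun x y _ h => by simpa using hmin x y h
  | succ n ih =>
    intro x y hxy hc
    -- Descending one level loses a factor r_i⁻¹ ≥ q⁻¹ of conductance.
    obtain ⟨w, a, b, hab, rfl', rfl'', hle⟩ := H.exists_Fw_eq_of_c_pos n 1 hxy hc
    have hne : a ≠ b := fun h => hxy (Subtype.ext (by rw [← rfl', ← rfl'', h]))
    refine (ih a b hne hab).trans ?_
    rw [pow_succ, mul_assoc]
    refine mul_le_mul_of_nonneg_left ?_ (by positivity)
    refine le_trans ?_ (mul_le_mul_of_nonneg_left hle hq0.le)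
    rw [← mul_assoc]
    refine le_mul_of_one_le_left hab.le ?_
    rw [Fin.prod_univ_one, ← div_eq_mul_inv, one_le_div (H.r_pos _)]
    exact hq _

/-- Zero energy on each 1-cell makes the function constant there by nondegeneracy, and the cells are
connected through images of `V_0`. -/
theorem eq_of_levelEnergy_one_eq_zero (h : P.V 1 → ℝ) (h0 : energy (H.c 1) h = 0)
    (x y : P.V 1) : h x = h y := by
  obtain ⟨o, ho⟩ := P.V_zero_nonempty
  have hcell : ∀ i (a b : P.V 0), h (P.mapV i a) = h (P.mapV i b) := by
    intro i a b
    refine H.nondegenerate (fun x => h (P.mapV i x)) ?_ a b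
    rw [H.selfSimilar] at h0
    have := (Finset.sum_eq_zero_iff_of_nonneg (fun i _ =>
      mul_nonneg (inv_nonneg.2 (H.r_pos i).le) (energy_nonneg (H.c_nonneg 0) _))).1 h0 i
      (Finset.mem_univ i)
    exact (mul_eq_zero.1 this).resolve_left (inv_ne_zero (H.r_pos i).ne')
  have key := P.eq_of_const_on_cells (α := fun i => h (P.mapV i ⟨o, ho⟩)) (by
    rintro i j ⟨x, hx, y, hy, hE⟩
    rw [hcell i ⟨o, ho⟩ ⟨x, hx⟩, hcell j ⟨o, ho⟩ ⟨y, hy⟩]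
    exact congrArg h (Subtype.ext hE))
  obtain ⟨x, hx⟩ := x
  obtain ⟨y, hy⟩ := y
  obtain ⟨i, a, ha, rfl⟩ := Set.mem_iUnion.1 hx
  obtain ⟨j, b, hb, rfl⟩ := Set.mem_iUnion.1 hy
  exact (hcell i ⟨a, ha⟩ ⟨o, ho⟩).trans ((key i j).trans (hcell j ⟨o, ho⟩ ⟨b, hb⟩))

/-- Points are uniformly of finite resistance from each other. -/
theorem exists_sq_sub_le_levelEnergy : ∃ A, 0 ≤ A ∧ ∀ n (h : EuclideanSpace ℝ (Fin d) → ℝ),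
    ∀ x ∈ P.V n, ∀ y ∈ P.V n, (h x - h y) ^ 2 ≤ A * H.levelEnergy n h := by
  obtain ⟨q, hq0, hq1, hq⟩ := H.exists_r_le
  obtain ⟨C₀, hC₀, hb₀⟩ := exists_sq_sub_le_energy (H.c_nonneg 0) H.nondegenerate
  obtain ⟨C₁, hC₁, hb₁⟩ := exists_sq_sub_le_energy (H.c_nonneg 1) H.eq_of_levelEnergy_one_eq_zero
  set s := √q with hs
  have hs1 : s < 1 := by rw [hs, Real.sqrt_lt' one_pos]; simpa using hq1
  have hs0 : 0 ≤ s := Real.sqrt_nonneg _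
  set C := max √C₀ √C₁ with hC
  have hC0 : 0 ≤ C := (Real.sqrt_nonneg _).trans (le_max_left _ _)
  -- The fixed point of A = sA + C: moving up a level costs `C` inside `V_1`, while the root of the
  -- energy of a cell is at most s = √q times the total.
  set A := C / (1 - s) with hA
  have hsA : A = s * A + C := by
    have : 1 - s ≠ 0 := by linarith
    rw [hA]; field_simp; ring
  have hA0 : 0 ≤ A := div_nonneg hC0 (by linarith)
  have hCA : C ≤ A := by nlinarith [mul_nonneg hs0 hA0]
  have key : ∀ n (h : EuclideanSpace ℝ (Fin d) → ℝ), ∀ x ∈ P.V n, ∀ a ∈ P.V 0,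
      |h x - h a| ≤ A * √(H.levelEnergy n h) := by
    intro n
    induction n with
    | zero =>
      intro h x hx a ha
      have := Real.abs_le_sqrt (hb₀ (fun x => h x) ⟨x, hx⟩ ⟨a, ha⟩)
      rw [Real.sqrt_mul hC₀] at this
      refine this.trans (mul_le_mul_of_nonneg_right ?_ (Real.sqrt_nonneg _))
      exact (le_max_left _ _).trans hCA
    | succ n ih =>
      intro h x hx a ha
      obtain ⟨i, y, hy, rfl⟩ := Set.mem_iUnion.1 hx
      have h1 := ih (fun x => h (P.F i x)) y hy a ha
      have h2 := Real.abs_le_sqrt (hb₁ (fun x => h x) ⟨P.F i a, P.F_mem_V 0 i ha⟩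
        ⟨a, P.V_subset_succ 0 ha⟩)
      rw [Real.sqrt_mul hC₁] at h2
      have h3 : √(energy (H.c 1) fun x => h x) ≤ √(H.levelEnergy (n + 1) h) :=
        Real.sqrt_le_sqrt (H.levelEnergy_mono (by omega) h)
      have h4 : √(H.levelEnergy n (fun x => h (P.F i x))) ≤ s * √(H.levelEnergy (n + 1) h) := by
        rw [hs, ← Real.sqrt_mul hq0.le]
        refine Real.sqrt_le_sqrt ?_
        have := Finset.single_le_sum (f := fun i => (H.r i)⁻¹ *
          H.levelEnergy n (fun x => h (P.F i x))) (fun i _ => mul_nonneg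
            (inv_nonneg.2 (H.r_pos i).le) (H.levelEnergy_nonneg n _)) (Finset.mem_univ i)
        rw [← H.levelEnergy_succ, inv_mul_le_iff₀ (H.r_pos i)] at this
        exact this.trans (mul_le_mul_of_nonneg_right (hq i) (H.levelEnergy_nonneg _ _))
      calc |h (P.F i y) - h a| = |(h (P.F i y) - h (P.F i a)) + (h (P.F i a) - h a)| := by
            ring_nf
        _ ≤ |h (P.F i y) - h (P.F i a)| + |h (P.F i a) - h a| := abs_add_le _ _
        _ ≤ A * (s * √(H.levelEnergy (n + 1) h)) + C * √(H.levelEnergy (n + 1) h) := by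
            refine add_le_add (h1.trans (mul_le_mul_of_nonneg_left h4 hA0)) (h2.trans ?_)
            exact mul_le_mul (le_max_right _ _) h3 (Real.sqrt_nonneg _) hC0
        _ = (s * A + C) * √(H.levelEnergy (n + 1) h) := by ring
        _ = A * √(H.levelEnergy (n + 1) h) := by rw [← hsA]
  obtain ⟨o, ho⟩ := P.V_zero_nonempty
  refine ⟨(2 * A) ^ 2, by positivity, fun n h x hx y hy => ?_⟩
  have h1 := key n h x hx o ho
  have h2 := key n h y hy o ho
  have h3 : |h x - h y| ≤ 2 * A * √(H.levelEnergy n h) := by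
    calc |h x - h y| = |(h x - h o) - (h y - h o)| := by ring_nf
      _ ≤ _ := (abs_sub _ _).trans (by linarith)
  calc (h x - h y) ^ 2 = |h x - h y| ^ 2 := (sq_abs _).symm
    _ ≤ (2 * A * √(H.levelEnergy n h)) ^ 2 := by gcongr
    _ = _ := by rw [mul_pow, Real.sq_sqrt (H.levelEnergy_nonneg n h)]

end HarmonicStructure

namespace Fractal

variable (P : Fractal d N)

theorem exists_Fw_eq_of_mem_V {l : ℕ} {y : EuclideanSpace ℝ (Fin d)} (hy : y ∈ P.V l) :
    ∃ (w : Fin l → Fin N), ∃ x ∈ P.V 0, P.Fw w x = y := by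
  induction l generalizing y with
  | zero => exact ⟨Fin.elim0, y, hy, rfl⟩
  | succ l ih =>
    obtain ⟨i, z, hz, rfl⟩ := Set.mem_iUnion.1 hy
    obtain ⟨w, x, hx, rfl⟩ := ih hz
    exact ⟨Fin.cons i w, x, hx, rfl⟩

/-- The point is the image of a boundary point under some word. For the word `w` injectivity
applies; otherwise distinct cells meet only at boundary points. -/
theorem mem_V_zero_of_Fw_mem_V {l : ℕ} (w : Fin l → Fin N) {x : EuclideanSpace ℝ (Fin d)}
    (hx : x ∈ P.K) (h : P.Fw w x ∈ P.V l) : x ∈ P.V 0 := by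
  obtain ⟨w', x', hx', hE⟩ := P.exists_Fw_eq_of_mem_V h
  by_cases hw : w' = w
  · subst hw
    rwa [← P.Fw_injective _ hE]
  · exact P.mem_V_zero_of_Fw_eq (Ne.symm hw) hx (P.V_subset_K 0 hx') hE.symm

end Fractal

/-! ### Dirichlet energy on the fundamental domain. -/

namespace HarmonicStructure

variable {P : Fractal d N} {H : HarmonicStructure P}

theorem inv_prod_r_pos (H : HarmonicStructure P) {l : ℕ} (w : Fin l → Fin N) :
    0 < (∏ j, H.r (w j))⁻¹ :=
  inv_pos.2 (Finset.prod_pos fun _ _ => H.r_pos _)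

namespace CycleBasis

variable {m : ℕ} (B : H.CycleBasis m)

theorem cell_injective {w : Fin (m + 1) → Fin N} {x y : P.K} (h : B.cell w x = B.cell w y) :
    x = y :=
  Subtype.ext (P.Fw_injective w
    (congrArg (fun p : B.FundDomain => (p.pt : EuclideanSpace ℝ (Fin d))) h))

theorem continuous_cell (w : Fin (m + 1) → Fin N) : Continuous (B.cell w) :=
  continuous_iff_coinduced_le.2 (le_iSup (fun w => TopologicalSpace.coinduced (B.cell w) _) w)

theorem cutEnergy_sub_const (k : ℕ) (f : B.FundDomain → ℝ) (s : ℝ) :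
    B.cutEnergy k (fun p => f p - s) = B.cutEnergy k f := by
  simp [cutEnergy, energy]

theorem cutEnergy_nonneg (k : ℕ) (f : B.FundDomain → ℝ) : 0 ≤ B.cutEnergy k f :=
  Finset.sum_nonneg fun w _ => mul_nonneg (H.inv_prod_r_pos w).le (energy_nonneg (H.c_nonneg k) _)

/-- Since `h` does not distinguish the two copies of a cut vertex, its energy on the fundamental
domain is its ordinary energy on level k + m + 1. -/
theorem cutEnergy_add (k : ℕ) (f : B.FundDomain → ℝ) (h : EuclideanSpace ℝ (Fin d) → ℝ) :
    B.cutEnergy k (fun p => f p + h p.pt) = B.cutEnergy k f +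
      (∑ w : Fin (m + 1) → Fin N, (∏ j, H.r (w j))⁻¹ * energyPolar (H.c k)
        (fun x => f (B.cell w (P.toK x))) fun x => h (P.Fw w x)) +
      H.levelEnergy (k + (m + 1)) h := by
  rw [H.levelEnergy_add, cutEnergy, cutEnergy, ← Finset.sum_add_distrib, ← Finset.sum_add_distrib]
  refine Finset.sum_congr rfl fun w _ => ?_
  rw [← mul_add, ← mul_add]
  exact congrArg _ (energy_add _ _ _)

/-- Competitors need only the right jumps: subtracting a constant restores the normalization at no
cost in energy. -/
theorem Admissible.of_sub {B : H.CycleBasis m} {ρ : Fin B.b → ℤ} {v₁ : B.FundDomain}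
    {f : B.FundDomain → ℝ} (hf : ∀ i, f (B.zPlus i) = f (B.zMinus i) + ρ i) :
    B.Admissible ρ v₁ (fun p => f p - f v₁) :=
  ⟨sub_self _, fun i => by simp only [hf]; ring⟩

/-- Minimizers are orthogonal to the functions on `K`. -/
theorem cutEnergy_add_of_minimal {ρ : Fin B.b → ℤ} {v₁ : B.FundDomain} {f : B.FundDomain → ℝ}
    (hf : B.Admissible ρ v₁ f) (k : ℕ)
    (hmin : ∀ g, B.Admissible ρ v₁ g → B.cutEnergy k f ≤ B.cutEnergy k g)
    (h : EuclideanSpace ℝ (Fin d) → ℝ) :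
    B.cutEnergy k (fun p => f p + h p.pt) = B.cutEnergy k f + H.levelEnergy (k + (m + 1)) h := by
  rw [cutEnergy_add]
  set b := ∑ w : Fin (m + 1) → Fin N, (∏ j, H.r (w j))⁻¹ * energyPolar (H.c k)
        (fun x => f (B.cell w (P.toK x))) fun x => h (P.Fw w x) with hb
  have key : ∀ s : ℝ, 0 ≤ s * b + s ^ 2 * H.levelEnergy (k + (m + 1)) h := by
    intro s
    have h1 := hmin _ (Admissible.of_sub (v₁ := v₁) (ρ := ρ)
      (f := fun p => f p + s * h p.pt) fun i => by
        have : (B.zPlus i).pt = (B.zMinus i).pt := rfl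
        simp only [hf.2 i, this]; ring)
    rw [B.cutEnergy_sub_const, B.cutEnergy_add k f (fun x => s * h x)] at h1
    have h2 : H.levelEnergy (k + (m + 1)) (fun x => s * h x) =
      s ^ 2 * H.levelEnergy (k + (m + 1)) h := energy_smul _ _ _
    have h3 : ∀ w : Fin (m + 1) → Fin N, energyPolar (H.c k)
        (fun x => f (B.cell w (P.toK x))) (fun x => s * h (P.Fw w x)) =
        s * energyPolar (H.c k) (fun x => f (B.cell w (P.toK x))) fun x => h (P.Fw w x) := by
      intro w
      simp only [energyPolar, Finset.mul_sum]
      exact Finset.sum_congr rfl fun x _ => Finset.sum_congr rfl fun y _ => by ring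
    rw [h2] at h1
    simp only [h3, mul_left_comm _ s, ← Finset.mul_sum] at h1
    rw [← hb] at h1
    linarith
  have hE := H.levelEnergy_nonneg (k + (m + 1)) h
  set e := H.levelEnergy (k + (m + 1)) h
  have hb0 : b = 0 := by
    -- A multiple of -b small enough to make the linear term dominate; e + 1 covers the case e = 0.
    have h1 := key (-b / (2 * (e + 1)))
    have h2 : -b / (2 * (e + 1)) * b + (-b / (2 * (e + 1))) ^ 2 * e =
        -(b ^ 2 * (e + 2)) / (4 * (e + 1) ^ 2) := by field_simp; ring
    rw [h2, le_div_iff₀ (by positivity)] at h1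
    have h3 : b ^ 2 * 2 ≤ b ^ 2 * (e + 2) := by gcongr; linarith
    have : b ^ 2 = 0 := le_antisymm (by linarith) (sq_nonneg b)
    exact pow_eq_zero_iff (two_ne_zero) |>.1 this
  rw [hb0, add_zero]

open Classical in
/-- Harmonic extension inside the cells does not increase the energy. -/
theorem cutEnergy_succ_le {ρ : Fin B.b → ℤ} {v₁ : B.FundDomain} {f : B.FundDomain → ℝ}
    (hf : B.Admissible ρ v₁ f) (k : ℕ)
    (hmin : ∀ g, B.Admissible ρ v₁ g → B.cutEnergy (k + 1) f ≤ B.cutEnergy (k + 1) g) :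
    B.cutEnergy (k + 1) f ≤ B.cutEnergy k f := by
  choose v hv hve using fun w => (H.compatible k (fun x => f (B.cell w (P.toK x)))).1
  have hv0 : ∀ w (x : P.V (k + 1)), (x : EuclideanSpace ℝ (Fin d)) ∈ P.V 0 →
      v w x = f (B.cell w (P.toK x)) := fun w x hx => hv w ⟨x, P.V_mono (Nat.zero_le k) hx⟩
  -- The energy-preserving extensions in the cells are glued. The arbitrary choice of cell is
  -- harmless: cells meet only over images of `V_0`, where every extension equals `f`.
  let g : B.FundDomain → ℝ := fun p =>
    if h : ∃ (w : Fin (m + 1) → Fin N) (x : P.V (k + 1)), B.cell w (P.toK x) = p then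
      v h.choose h.choose_spec.choose else f p
  have hg : ∀ w x, g (B.cell w (P.toK x)) = v w x := by
    intro w x
    have h : ∃ (w' : Fin (m + 1) → Fin N) (x' : P.V (k + 1)),
      B.cell w' (P.toK x') = B.cell w (P.toK x) := ⟨w, x, rfl⟩
    have hE : g (B.cell w (P.toK x)) = v h.choose h.choose_spec.choose := dif_pos h
    have hs := h.choose_spec.choose_spec
    rw [hE]
    generalize h.choose_spec.choose = x' at hs ⊢
    generalize h.choose = w' at hs ⊢
    by_cases hw : w' = w
    · subst hw
      have : x' = x := Subtype.ext (congrArg (fun p : P.K => (p : EuclideanSpace ℝ (Fin d)))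
        (B.cell_injective hs))
      rw [this]
    · have hpt : P.Fw w' x' = P.Fw w x :=
        congrArg (fun p : B.FundDomain => (p.pt : EuclideanSpace ℝ (Fin d))) hs
      rw [hv0 w' x' (P.mem_V_zero_of_Fw_eq hw (P.V_subset_K _ x'.2) (P.V_subset_K _ x.2) hpt),
        hv0 w x (P.mem_V_zero_of_Fw_eq (Ne.symm hw) (P.V_subset_K _ x.2) (P.V_subset_K _ x'.2)
          hpt.symm), hs]
  -- In particular at both copies of each cut vertex, so the jumps survive.
  have hgf : ∀ p : B.FundDomain, (p.pt : EuclideanSpace ℝ (Fin d)) ∈ P.V (m + 1) → g p = f p := by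
    intro p hp
    by_cases h : ∃ (w : Fin (m + 1) → Fin N) (x : P.V (k + 1)), B.cell w (P.toK x) = p
    · obtain ⟨w, x, rfl⟩ := h
      rw [hg, hv0 w x (P.mem_V_zero_of_Fw_mem_V w (P.V_subset_K _ x.2) hp)]
    · exact dif_neg h
  have h1 := hmin _ (Admissible.of_sub (v₁ := v₁) (ρ := ρ) (f := g) fun i => by
    rw [hgf _ (B.ξ i).2, hgf _ (B.ξ i).2, hf.2])
  rw [B.cutEnergy_sub_const] at h1
  refine h1.trans_eq (Finset.sum_congr rfl fun w _ => ?_)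
  simp only [hg]
  rw [hve w]

theorem cutEnergy_le_zero {ρ : Fin B.b → ℤ} {v₁ : B.FundDomain} {f : B.FundDomain → ℝ}
    (hf : B.Admissible ρ v₁ f)
    (hmin : ∀ k g, B.Admissible ρ v₁ g → B.cutEnergy k f ≤ B.cutEnergy k g) (k : ℕ) :
    B.cutEnergy k f ≤ B.cutEnergy 0 f :=
  antitone_nat_of_succ_le (f := fun k => B.cutEnergy k f)
    (fun k => B.cutEnergy_succ_le hf k (hmin (k + 1))) (Nat.zero_le k)

end CycleBasis

end HarmonicStructure

/-! ### Degrees along curves, and the degree of the harmonic map. -/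

/-- Adding a real-valued function does not change the degree. -/
theorem HasDegree.of_sub_eq_coe {X : Type*} [TopologicalSpace X] {f g : C(X, UnitAddCircle)}
    {x : X} {c : Path x x} {k : ℤ} (hf : HasDegree f c k) (s : C(X, ℝ))
    (hg : ∀ x, g x = f x + (s x : UnitAddCircle)) : HasDegree g c k := by
  obtain ⟨h, hh, hk⟩ := hf
  refine ⟨h + s.comp c.toContinuousMap, fun t => ?_, ?_⟩
  · rw [ContinuousMap.add_apply, AddCircle.coe_add, hh, hg]
    rfl
  · have : ((s.comp c.toContinuousMap) 1 : ℝ) = (s.comp c.toContinuousMap) 0 := by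
      change s (c 1) = s (c 0)
      rw [c.source, c.target]
    rw [ContinuousMap.add_apply, ContinuousMap.add_apply, this, ← hk]
    ring

theorem eq_of_forall_eq_int {X : Type*} [TopologicalSpace X] [PreconnectedSpace X] {φ : X → ℝ}
    (hφ : Continuous φ) (h : ∀ x, ∃ n : ℤ, φ x = n) (x y : X) : φ x = φ y := by
  choose ψ hψ using h
  have hc : Continuous ψ := by
    rw [Int.isClosedEmbedding_coe_real.isInducing.continuous_iff]
    exact hφ.congr hψ
  rw [hψ, hψ, PreconnectedSpace.constant inferInstance hc]

theorem sum_succ_sub_castSucc {n : ℕ} (a : Fin (n + 1) → ℝ) :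
    ∑ k : Fin n, (a k.succ - a k.castSucc) = a (Fin.last n) - a 0 := by
  have h1 := Fin.sum_univ_succ a
  have h2 := Fin.sum_univ_castSucc a
  rw [Finset.sum_sub_distrib]
  linarith

theorem exists_int_of_coe_eq {x y : ℝ} (h : (x : UnitAddCircle) = y) : ∃ n : ℤ, x - y = n := by
  have h0 : ((x - y : ℝ) : UnitAddCircle) = 0 := by rw [AddCircle.coe_sub, h, sub_self]
  obtain ⟨n, hn⟩ := (AddCircle.coe_eq_zero_iff (1 : ℝ)).1 h0
  exact ⟨n, by rw [← hn]; simp⟩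

namespace HarmonicStructure

variable {P : Fractal d N} {H : HarmonicStructure P}

namespace CycleBasis

variable {m : ℕ} (B : H.CycleBasis m)

/-- Along a curve in an `(m+1)`-cell, a lift of the projection of `f : K⁰ → ℝ` and `f` itself have
the same increment. -/
theorem lift_sub_eq {f : B.FundDomain → ℝ} (hf : Continuous f) {u : C(P.K, UnitAddCircle)}
    (hu : ∀ p : B.FundDomain, u p.pt = (f p : UnitAddCircle)) {c : unitInterval → P.K}
    (hc : Continuous c) {θ : unitInterval → ℝ} (hθc : Continuous θ)
    (hθ : ∀ t, (θ t : UnitAddCircle) = u (c t)) {s t : unitInterval} (hst : s ≤ t)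
    {w : Fin (m + 1) → Fin N}
    (hw : ∀ τ ∈ Set.Icc s t, (c τ : EuclideanSpace ℝ (Fin d)) ∈ P.Fw w '' P.K) :
    ∃ x y : P.K, P.Fw w x = c s ∧ P.Fw w y = c t ∧
      θ t - θ s = f (B.cell w y) - f (B.cell w x) := by
  choose z hzK hz using fun τ : Set.Icc s t => hw τ τ.2
  let z' : Set.Icc s t → P.K := fun τ => ⟨z τ, hzK τ⟩
  have : CompactSpace P.K := isCompact_iff_compactSpace.1 P.isCompact
  -- By compactness of `K`, the curve pulls back continuously to the cell; there the lift minus `f`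
  -- is continuous and integer-valued.
  have hemb : Topology.IsClosedEmbedding fun x : P.K => P.Fw w x :=
    ((P.continuous_Fw w).comp continuous_subtype_val).isClosedEmbedding
      ((P.Fw_injective w).comp Subtype.val_injective)
  have hz' : Continuous z' := by
    rw [hemb.isInducing.continuous_iff]
    exact (continuous_subtype_val.comp (hc.comp continuous_subtype_val)).congr
      fun τ => (hz τ).symm
  have : PreconnectedSpace (Set.Icc s t) := Subtype.preconnectedSpace isPreconnected_Icc
  have key := eq_of_forall_eq_int (φ := fun τ : Set.Icc s t => θ τ - f (B.cell w (z' τ)))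
    ((hθc.comp continuous_subtype_val).sub (hf.comp ((B.continuous_cell w).comp hz')))
    (fun τ => exists_int_of_coe_eq (by
      rw [hθ, ← hu]
      exact congrArg u (Subtype.ext (hz τ).symm)))
    ⟨s, Set.left_mem_Icc.2 hst⟩ ⟨t, Set.right_mem_Icc.2 hst⟩
  refine ⟨z' ⟨s, Set.left_mem_Icc.2 hst⟩, z' ⟨t, Set.right_mem_Icc.2 hst⟩, hz _, hz _, ?_⟩
  dsimp only at key
  linarith

/-- The value of `f` at a vertex, at the copy `(ξ_i)_-` for a cut vertex. -/
def minusValue (f : B.FundDomain → ℝ) (x : P.V (m + 1)) : ℝ :=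
  f ⟨P.toK x, fun _ => false, fun _ _ => rfl⟩

theorem eq_of_ξ_mem_support {i j : Fin B.b} (h : B.ξ j ∈ (B.ι i).support) : j = i := by
  by_contra hne
  exact B.ξ_notMem j i (Ne.symm hne) h

open Classical in
-- The only cut vertex on `ι(γ_i)` is `ξ_i`, so the copy seen by a cell matters only there.
theorem apply_cell_eq {ρ : Fin B.b → ℤ} {f : B.FundDomain → ℝ}
    (hf : ∀ i, f (B.zPlus i) = f (B.zMinus i) + ρ i) {i : Fin B.b} {x : P.V (m + 1)}
    (hx : x ∈ (B.ι i).support) {w : Fin (m + 1) → Fin N} {z : P.K} (hz : P.Fw w z = x) :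
    f (B.cell w z) = B.minusValue f x + if x = B.ξ i ∧ B.side i w = true then (ρ i : ℝ) else 0 := by
  have hpt : (B.cell w z).pt = P.toK x := Subtype.ext hz
  have hj : ∀ j, P.Fw w z = B.ξ j → j = i ∧ x = B.ξ j := fun j h => by
    have : x = B.ξ j := Subtype.ext (hz.symm.trans h)
    exact ⟨B.eq_of_ξ_mem_support (this ▸ hx), this⟩
  split_ifs with h
  · have h1 : B.cell w z = B.zPlus i := by
      refine FundDomain.ext (by rw [hpt, h.1]; rfl) (funext fun j => ?_)
      change (if P.Fw w z = B.ξ j then B.side j w else false) = decide (j = i)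
      by_cases hji : j = i
      · subst hji
        rw [if_pos (by rw [hz, h.1]), h.2]; simp
      · rw [if_neg fun h' => hji (hj j h').1]; simp [hji]
    have h2 : B.minusValue f x = f (B.zMinus i) := by rw [h.1]; rfl
    rw [h1, h2, hf]
  · rw [add_zero]
    refine congrArg f (FundDomain.ext hpt (funext fun j => ?_))
    change (if P.Fw w z = B.ξ j then B.side j w else false) = false
    split_ifs with h'
    · obtain ⟨rfl, hx'⟩ := hj j h'
      simpa [hx'] using h
    · rfl

/-- The harmonic map of degree `ρ` has degree `ρ`. -/
theorem hasDegreeVector_of_isHarmonicMap {ρ : Fin B.b → ℤ} {f : B.FundDomain → ℝ}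
    (hfc : Continuous f) (hf : ∀ i, f (B.zPlus i) = f (B.zMinus i) + ρ i)
    {u : C(P.K, UnitAddCircle)} (hu : ∀ p : B.FundDomain, u p.pt = (f p : UnitAddCircle)) :
    B.HasDegreeVector u ρ := by
  classical
  intro i
  obtain ⟨t, htm, ht0, ht1, hvert, hcell⟩ := B.curve_ι i
  obtain ⟨e, he⟩ := QuotientAddGroup.mk_surjective (u (B.curve i 0))
  obtain ⟨θ, hθ, -⟩ := (AddCircle.isCoveringMap_coe (1 : ℝ)).exists_path_lifts
    (u.comp (B.curve i).toContinuousMap) e he.symm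
  have hθ' : ∀ t, (θ t : UnitAddCircle) = u (B.curve i t) := fun t => congrFun hθ t
  refine ⟨θ, hθ', ?_⟩
  have hstep : ∀ k : Fin (B.ι i).length, θ (t k.succ) - θ (t k.castSucc) =
      (B.minusValue f ((B.ι i).getVert k.succ) - B.minusValue f ((B.ι i).getVert k.castSucc)) +
        if (B.ι i).getVert (k + 1) = B.ξ i then (ρ i : ℝ) else 0 := by
    intro k
    obtain ⟨x, y, hx, hy, hE⟩ := B.lift_sub_eq hfc hu (B.curve i).continuous θ.continuous hθ'
      (htm (Fin.castSucc_lt_succ (i := k)).le) (hcell k).1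
    rw [hvert] at hx hy
    rw [hE, B.apply_cell_eq hf ((B.ι i).getVert_mem_support _) hx,
      B.apply_cell_eq hf ((B.ι i).getVert_mem_support _) hy]
    have h1 : ¬ ((B.ι i).getVert (k.castSucc : Fin _) = B.ξ i ∧ B.side i (B.word i k) = true) := by
      rintro ⟨h1, h2⟩
      rw [B.leaves i k h1] at h2
      exact Bool.false_ne_true h2
    rw [if_neg h1]
    have h2 : ((B.ι i).getVert (k.succ : Fin _) = B.ξ i ∧ B.side i (B.word i k) = true) ↔
        (B.ι i).getVert (k + 1) = B.ξ i := ⟨fun h => h.1, fun h => ⟨h, B.arrives i k h⟩⟩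
    simp only [h2]
    ring
  have hsum := sum_succ_sub_castSucc fun k => θ (t k)
  rw [ht0, ht1] at hsum
  rw [← hsum, Finset.sum_congr rfl fun k _ => hstep k, Finset.sum_add_distrib,
    sum_succ_sub_castSucc fun k => B.minusValue f ((B.ι i).getVert k)]
  have h3 := (B.ι_isCycle i).three_le_length
  -- Arrivals are indexed by 1, ..., length, where the vertices of a cycle are distinct; if `ξ_i` is
  -- the base point, the arrival is the last step.
  obtain ⟨n, hn, hn1, hnL⟩ : ∃ n, (B.ι i).getVert (n + 1) = B.ξ i ∧ 1 ≤ n + 1 ∧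
      n + 1 ≤ (B.ι i).length := by
    obtain ⟨n, hn, hnL⟩ := SimpleGraph.Walk.mem_support_iff_exists_getVert.1 (B.ξ_mem i)
    rcases n with _ | n
    · refine ⟨(B.ι i).length - 1, ?_, by omega, by omega⟩
      rw [Nat.sub_add_cancel (by omega), SimpleGraph.Walk.getVert_length, ← hn,
        SimpleGraph.Walk.getVert_zero]
    · exact ⟨n, hn, by omega, hnL⟩
  rw [Finset.sum_eq_single (⟨n, hnL⟩ : Fin (B.ι i).length), if_pos hn]
  · simp
  · intro k _ hk
    refine if_neg fun h => hk (Fin.ext ?_)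
    have := (B.ι_isCycle i).getVert_injOn (show (k : ℕ) + 1 ∈ {i_1 | _} from ⟨by omega, k.2⟩)
      (show n + 1 ∈ {i_1 | _} from ⟨hn1, hnL⟩) (h.trans hn.symm)
    simpa using this
  · simp

end CycleBasis

end HarmonicStructure

/-! ### Short edges imply Lyapunov stability. -/

theorem sinTwoPi_neg (x : UnitAddCircle) : sinTwoPi (-x) = -sinTwoPi x := by
  obtain ⟨y, rfl⟩ := QuotientAddGroup.mk_surjective x
  change sinTwoPi (-(y : UnitAddCircle)) = -sinTwoPi (y : UnitAddCircle)
  rw [← AddCircle.coe_neg, sinTwoPi_coe, sinTwoPi_coe, ← Real.sin_neg]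
  ring_nf

theorem exists_coe_eq_abs_eq_norm (x : UnitAddCircle) : ∃ y : ℝ, (y : UnitAddCircle) = x ∧
    |y| = ‖x‖ := by
  obtain ⟨z, rfl⟩ := QuotientAddGroup.mk_surjective x
  refine ⟨z - round z, ?_, (UnitAddCircle.norm_eq (x := z)).symm⟩
  have : ((round z : ℝ) : UnitAddCircle) = 0 :=
    (AddCircle.coe_eq_zero_iff (1 : ℝ)).2 ⟨round z, by simp⟩
  rw [AddCircle.coe_sub, this, sub_zero]

theorem norm_coe_le_abs (y : ℝ) : ‖(y : UnitAddCircle)‖ ≤ |y| := by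
  rw [UnitAddCircle.norm_eq]
  simpa using round_le y 0

/-- Both phases stay within 1/4, that is, both angles within π/2, where sine increases. -/
theorem mul_sin_sub_sin_nonneg {e δ : ℝ} (he : |e| ≤ 1 / 8) (hδ : |δ| ≤ 1 / 8) :
    0 ≤ δ * (Real.sin (2 * Real.pi * (e + δ)) - Real.sin (2 * Real.pi * e)) := by
  have hpi := Real.pi_pos
  rw [abs_le] at he hδ
  have h1 : 2 * Real.pi * e ∈ Set.Icc (-(Real.pi / 2)) (Real.pi / 2) := by
    constructor <;> nlinarith
  have h2 : 2 * Real.pi * (e + δ) ∈ Set.Icc (-(Real.pi / 2)) (Real.pi / 2) := by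
    constructor <;> nlinarith
  rcases le_total 0 δ with h | h
  · exact mul_nonneg h (sub_nonneg.2 (Real.strictMonoOn_sin.monotoneOn h1 h2 (by nlinarith)))
  · exact mul_nonneg_of_nonpos_of_nonpos h
      (sub_nonpos.2 (Real.strictMonoOn_sin.monotoneOn h2 h1 (by nlinarith)))

namespace HarmonicStructure

variable {P : Fractal d N} (H : HarmonicStructure P)

/-- The Kuramoto flow does not increase the `ℓ²`-distance to a steady state with short edges. -/
theorem sum_mul_kmField_nonpos {n : ℕ} {u v : P.V n → UnitAddCircle}
    (hu : ∀ x, H.kmField n u x = 0)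
    (he : ∀ x y, x ≠ y → 0 < H.c n x y → ∃ e : ℝ, (e : UnitAddCircle) = u y - u x ∧ |e| ≤ 1 / 8)
    {D : P.V n → ℝ} (hv : ∀ x, v x = u x + (D x : UnitAddCircle)) (hD : ∀ x, |D x| ≤ 1 / 16) :
    ∑ x, D x * H.kmField n v x ≤ 0 := by
  have h1 : ∑ x, D x * H.kmField n v x =
      ∑ x, ∑ y, H.c n x y * (D x * (sinTwoPi (v y - v x) - sinTwoPi (u y - u x))) := by
    refine Finset.sum_congr rfl fun x _ => ?_
    rw [← sub_zero (H.kmField n v x), ← hu x, kmField, kmField, ← Finset.sum_sub_distrib,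
      Finset.mul_sum]
    exact Finset.sum_congr rfl fun y _ => by ring
  have h2 : ∑ x, D x * H.kmField n v x =
      ∑ x, ∑ y, H.c n x y * (-D y * (sinTwoPi (v y - v x) - sinTwoPi (u y - u x))) := by
    rw [h1, Finset.sum_comm]
    refine Finset.sum_congr rfl fun x _ => Finset.sum_congr rfl fun y _ => ?_
    rw [H.c_symm, ← neg_sub (v y), ← neg_sub (u y), sinTwoPi_neg, sinTwoPi_neg]
    ring
  have h3 : 2 * ∑ x, D x * H.kmField n v x =
      ∑ x, ∑ y, -(H.c n x y * ((D y - D x) * (sinTwoPi (v y - v x) - sinTwoPi (u y - u x)))) := by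
    rw [two_mul]
    nth_rewrite 1 [h1]
    rw [h2]
    simp only [← Finset.sum_add_distrib]
    exact Finset.sum_congr rfl fun x _ => Finset.sum_congr rfl fun y _ => by ring
  suffices 2 * ∑ x, D x * H.kmField n v x ≤ 0 by linarith
  rw [h3]
  refine Finset.sum_nonpos fun x _ => Finset.sum_nonpos fun y _ => neg_nonpos.2 ?_
  rcases (H.c_nonneg n x y).eq_or_lt with h0 | hpos
  · rw [← h0, zero_mul]
  by_cases hxy : x = y
  · rw [hxy, sub_self, zero_mul, mul_zero]
  obtain ⟨e, heq, hle⟩ := he x y hxy hpos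
  have hvxy : v y - v x = ((e + (D y - D x) : ℝ) : UnitAddCircle) := by
    rw [AddCircle.coe_add, AddCircle.coe_sub, heq, hv, hv]
    abel
  rw [hvxy, ← heq, sinTwoPi_coe, sinTwoPi_coe]
  refine mul_nonneg hpos.le (mul_sin_sub_sin_nonneg hle ?_)
  refine (abs_sub _ _).trans ?_
  linarith [hD x, hD y]

/-- The squared ℓ²-distance is a Lyapunov function as long as all displacements are at most 1/16; a
barrier argument shows that they remain so. -/
theorem isStableSteadyState_of_short_edges {n : ℕ} {u : P.V n → UnitAddCircle}
    (hu : ∀ x, H.kmField n u x = 0)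
    (he : ∀ x y, x ≠ y → 0 < H.c n x y →
      ∃ e : ℝ, (e : UnitAddCircle) = u y - u x ∧ |e| ≤ 1 / 8) :
    H.IsStableSteadyState n u := by
  refine ⟨hu, fun ε hε => ?_⟩
  set r := min ε (1 / 16) with hr
  have hr0 : 0 < r := lt_min hε (by norm_num)
  set q : ℝ := (Fintype.card (P.V n) : ℝ) with hq
  have hq0 : 0 ≤ q := Nat.cast_nonneg _
  refine ⟨r / (q + 1), by positivity, ?_⟩
  rintro v ⟨θ, hθv, hθ⟩ hδ t ht
  choose s hs hsn using fun x => exists_coe_eq_abs_eq_norm (v 0 x - u x)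
  -- A real-valued displacement from `u`, following the lifted flow and starting at the shortest
  -- representative.
  let D : ℝ → P.V n → ℝ := fun τ x => θ τ x - θ 0 x + s x
  have hvD : ∀ τ, 0 ≤ τ → ∀ x, v τ x = u x + (D τ x : UnitAddCircle) := by
    intro τ hτ x
    rw [AddCircle.coe_add, AddCircle.coe_sub, hθv τ hτ, hθv 0 le_rfl, hs]
    abel
  let Q : ℝ → ℝ := fun τ => ∑ x, D τ x ^ 2
  have hQ : ∀ τ, 0 ≤ τ → HasDerivWithinAt Q (2 * ∑ x, D τ x * H.kmField n (v τ) x)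
      (Set.Ici 0) τ := by
    intro τ hτ
    rw [Finset.mul_sum]
    refine HasDerivWithinAt.fun_sum fun x _ => ?_
    refine ((((hθ τ hτ x).sub_const (θ 0 x)).add_const (s x)).fun_pow 2).congr_deriv ?_
    rw [Nat.cast_ofNat, Nat.add_one_sub_one, pow_one, mul_assoc]
  have hQD : ∀ τ, Q τ < r ^ 2 → ∀ x, |D τ x| < r := by
    intro τ h x
    refine abs_lt_of_sq_lt_sq (lt_of_le_of_lt ?_ h) hr0.le
    exact Finset.single_le_sum (f := fun x => D τ x ^ 2) (fun x _ => sq_nonneg _)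
      (Finset.mem_univ x)
  have hQ0 : Q 0 < r ^ 2 := by
    have : Q 0 ≤ q * (r / (q + 1)) ^ 2 := by
      rw [show q = (Finset.univ : Finset (P.V n)).card from rfl, ← nsmul_eq_mul]
      change _ ≤ _ • (r / (q + 1)) ^ 2
      refine Finset.sum_le_card_nsmul _ _ _ fun x _ => ?_
      rw [← sq_abs (D 0 x)]
      have : |D 0 x| ≤ r / (q + 1) := by
        simp only [D, sub_self, zero_add, hsn]
        exact (hδ x).le
      gcongr
    refine this.trans_lt ?_
    rw [div_pow, mul_div_assoc', div_lt_iff₀ (by positivity), mul_comm]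
    exact mul_lt_mul_of_pos_left (by nlinarith) (by positivity)
  -- The slope η > 0 makes the comparison strict: where `Q` touches the line it is still below r²,
  -- so its derivative is at most 0 < η.
  have hle : ∀ η, 0 < η → Q 0 + η * t < r ^ 2 → Q t ≤ Q 0 + η * t := by
    intro η hη hηt
    refine image_le_of_deriv_right_lt_deriv_boundary (f := Q) (a := 0) (b := t)
      (f' := fun τ => 2 * ∑ x, D τ x * H.kmField n (v τ) x) (B := fun τ => Q 0 + η * τ)
      (B' := fun _ => η) ?_ ?_ ?_ ?_ ?_ ⟨ht, le_rfl⟩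
    · exact fun τ hτ => ((hQ τ hτ.1).continuousWithinAt).mono Set.Icc_subset_Ici_self
    · exact fun τ hτ => (hQ τ hτ.1).mono (Set.Ici_subset_Ici.2 hτ.1)
    · simp
    · intro τ
      simpa using ((hasDerivAt_id τ).const_mul η).const_add (Q 0)
    · intro τ hτ hE
      have h1 : Q τ < r ^ 2 := by
        rw [hE]
        refine lt_of_le_of_lt ?_ hηt
        have := hτ.2.le
        gcongr
      have := H.sum_mul_kmField_nonpos hu he (hvD τ hτ.1) (fun x =>
        ((hQD τ h1 x).le.trans (min_le_right _ _)))
      linarith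
  have hQt : Q t < r ^ 2 := by
    have h := hle ((r ^ 2 - Q 0) / (2 * (t + 1))) (by
      have : 0 < r ^ 2 - Q 0 := by linarith
      positivity)
    have h' : Q 0 + (r ^ 2 - Q 0) / (2 * (t + 1)) * t < r ^ 2 := by
      rw [div_mul_eq_mul_div, ← lt_sub_iff_add_lt', div_lt_iff₀ (by positivity)]
      nlinarith
    exact (h h').trans_lt h'
  intro x
  rw [hvD t ht x, add_sub_cancel_left]
  exact (norm_coe_le_abs _).trans_lt ((hQD t hQt x).trans_le (min_le_left _ _))

end HarmonicStructure

/-! ### The Kuramoto energy and its minimizers on a finite graph. -/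

/-- The interaction potential `(1 - cos 2πs) / (4π²)` of the Kuramoto model. -/
def potential (s : ℝ) : ℝ := (1 - Real.cos (2 * Real.pi * s)) / (4 * Real.pi ^ 2)

theorem potential_zero : potential 0 = 0 := by simp [potential]

theorem potential_eq_of_coe_eq {s t : ℝ} (h : (s : UnitAddCircle) = t) :
    potential s = potential t := by
  obtain ⟨n, hn⟩ := exists_int_of_coe_eq h
  have : 2 * Real.pi * s = 2 * Real.pi * t + n * (2 * Real.pi) := by
    rw [← hn]; ring
  rw [potential, potential, this, Real.cos_add_int_mul_two_pi]

theorem hasDerivAt_potential (s : ℝ) :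
    HasDerivAt potential (Real.sin (2 * Real.pi * s) / (2 * Real.pi)) s := by
  have h := ((((hasDerivAt_id s).const_mul (2 * Real.pi)).cos.const_sub 1).div_const
    (4 * Real.pi ^ 2))
  refine h.congr_deriv ?_
  have := Real.pi_ne_zero
  rw [id]
  field_simp
  ring

theorem continuous_potential : Continuous potential := by
  unfold potential
  fun_prop

theorem potential_le (s : ℝ) : potential s ≤ s ^ 2 / 2 := by
  have hpi := Real.pi_pos
  rw [potential, div_le_iff₀ (by positivity)]
  have := Real.one_sub_sq_div_two_le_cos (x := 2 * Real.pi * s)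
  nlinarith

/-- The fourth-order remainder of cosine is at most 10π²s⁴ (using π² ≤ 10), which is 4π² times
5s²·s²/2; this gives the constant 5. -/
theorem le_potential {s η : ℝ} (hs : s ^ 2 ≤ η ^ 2) (hη : |η| ≤ 1 / 8) :
    (1 - 5 * η ^ 2) * (s ^ 2 / 2) ≤ potential s := by
  have hpi := Real.pi_pos
  have hpi4 := Real.pi_lt_d2
  have hs8 : |s| ≤ 1 / 8 := (sq_le_sq.1 hs).trans hη
  rw [potential, le_div_iff₀ (by positivity)]
  have h1 : |2 * Real.pi * s| ≤ 1 := by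
    rw [abs_mul, abs_of_pos (by positivity)]
    nlinarith [abs_nonneg s]
  have h2 := (abs_le.1 (Real.cos_bound h1)).2
  have h3 : |2 * Real.pi * s| ^ 4 = (2 * Real.pi * s) ^ 4 := by
    rw [show (4 : ℕ) = 2 * 2 from rfl, pow_mul, sq_abs, ← pow_mul]
  rw [h3] at h2
  have h4 : (2 * Real.pi * s) ^ 4 * (5 / 96) ≤ 10 * Real.pi ^ 2 * (s ^ 2 * s ^ 2) := by
    have : Real.pi ^ 2 ≤ 10 := by nlinarith
    have h5 : Real.pi ^ 2 * (Real.pi ^ 2 * (s ^ 2 * s ^ 2)) ≤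
        10 * (Real.pi ^ 2 * (s ^ 2 * s ^ 2)) :=
      mul_le_mul_of_nonneg_right this (by positivity)
    nlinarith
  have h5 : Real.pi ^ 2 * (s ^ 2 * s ^ 2) ≤ Real.pi ^ 2 * (s ^ 2 * η ^ 2) := by gcongr
  nlinarith

section FiniteGraph

variable {V : Type*} [Fintype V]

/-- The Kuramoto energy of a real-valued lift. -/
def phaseEnergy (c : V → V → ℝ) (θ : V → ℝ) : ℝ :=
  ∑ x, ∑ y, c x y * potential (θ y - θ x)

theorem phaseEnergy_le {c : V → V → ℝ} (hc : ∀ x y, 0 ≤ c x y) (θ : V → ℝ) :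
    phaseEnergy c θ ≤ energy c θ :=
  Finset.sum_le_sum fun _ _ => Finset.sum_le_sum fun _ _ =>
    mul_le_mul_of_nonneg_left (potential_le _) (hc _ _)

theorem le_phaseEnergy {c : V → V → ℝ} (hc : ∀ x y, 0 ≤ c x y) {θ : V → ℝ} {η : ℝ}
    (hη : |η| ≤ 1 / 8) (hθ : ∀ x y, 0 < c x y → (θ y - θ x) ^ 2 ≤ η ^ 2) :
    (1 - 5 * η ^ 2) * energy c θ ≤ phaseEnergy c θ := by
  rw [energy, Finset.mul_sum]
  refine Finset.sum_le_sum fun x _ => ?_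
  rw [Finset.mul_sum]
  refine Finset.sum_le_sum fun y _ => ?_
  rcases (hc x y).eq_or_lt with h | h
  · simp [← h]
  · rw [mul_left_comm]
    exact mul_le_mul_of_nonneg_left (le_potential (hθ x y h) hη) h.le

theorem continuous_phaseEnergy (c : V → V → ℝ) : Continuous (phaseEnergy c) := by
  unfold phaseEnergy
  have := continuous_potential
  fun_prop

/-- The Kuramoto energy attains its minimum over the functions of energy at most one. -/
theorem exists_phaseEnergy_minimizer {c : V → V → ℝ} (hc : ∀ x y, 0 ≤ c x y) {C : ℝ}
    (hC : ∀ (u : V → ℝ) (x y : V), (u x - u y) ^ 2 ≤ C * energy c u) (U : V → ℝ) (o : V) :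
    ∃ h : V → ℝ, h o = 0 ∧ energy c h ≤ 1 ∧ ∀ h' : V → ℝ, energy c h' ≤ 1 →
      phaseEnergy c (fun x => U x + h x) ≤ phaseEnergy c (fun x => U x + h' x) := by
  -- Both energies ignore constants, so normalizing at `o` yields compactness without excluding
  -- competitors.
  let S : Set (V → ℝ) := {h | h o = 0} ∩ {h | energy c h ≤ 1}
  have hS : IsCompact S := by
    refine Metric.isCompact_of_isClosed_isBounded
      ((isClosed_eq (continuous_apply o) continuous_const).inter
        (isClosed_le (continuous_energy c) continuous_const)) ?_
    refine (Metric.isBounded_closedBall (x := (0 : V → ℝ)) (r := |C| + 1)).subset ?_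
    rintro h ⟨ho, he⟩
    rw [mem_closedBall_zero_iff, pi_norm_le_iff_of_nonneg (by positivity)]
    intro x
    have h1 := hC h x o
    rw [ho, sub_zero] at h1
    have h2 : C * energy c h ≤ |C| := by
      calc C * energy c h ≤ |C| * energy c h :=
            mul_le_mul_of_nonneg_right (le_abs_self C) (energy_nonneg hc h)
        _ ≤ |C| * 1 := mul_le_mul_of_nonneg_left he (abs_nonneg C)
        _ = |C| := mul_one _
    rw [Real.norm_eq_abs]
    refine abs_le_of_sq_le_sq ?_ (by positivity)
    nlinarith [abs_nonneg C]
  obtain ⟨h, ⟨h0, h1⟩, hm⟩ := hS.exists_isMinOn ⟨0, rfl, by simp [energy]⟩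
    (f := fun h => phaseEnergy c (fun x => U x + h x))
    ((continuous_phaseEnergy c).comp (by fun_prop)).continuousOn
  refine ⟨h, h0, h1, fun h' he => ?_⟩
  have := hm (show (fun x => h' x - h' o) ∈ S from
    ⟨sub_self _, by simpa [energy] using he⟩)
  refine le_of_le_of_eq this ?_
  simp only [phaseEnergy]
  refine Finset.sum_congr rfl fun x _ => Finset.sum_congr rfl fun y _ => ?_
  ring_nf

/-- Interior minimizers are critical points. -/
theorem sum_sin_eq_zero_of_minimizer {c : V → V → ℝ} (hs : ∀ x y, c x y = c y x) {U h : V → ℝ}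
    (h1 : energy c h < 1)
    (hmin : ∀ h' : V → ℝ, energy c h' ≤ 1 →
      phaseEnergy c (fun x => U x + h x) ≤ phaseEnergy c (fun x => U x + h' x)) (x : V) :
    ∑ y, c x y * Real.sin (2 * Real.pi * ((U y + h y) - (U x + h x))) = 0 := by
  classical
  -- The first variation at the vertex x; each edge occurs in both orientations, which turns 1/(2π)
  -- into 1/π.
  let e : V → ℝ := Pi.single x 1
  let g : ℝ → ℝ := fun t => phaseEnergy c (fun z => U z + (h z + t * e z))
  have hcont : Continuous fun t : ℝ => energy c (fun z => h z + t * e z) :=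
    (continuous_energy c).comp (by fun_prop)
  have hloc : IsLocalMin g 0 := by
    have hev : ∀ᶠ t in nhds (0 : ℝ), energy c (fun z => h z + t * e z) < 1 :=
      hcont.continuousAt.eventually_lt_const (by simpa using h1)
    filter_upwards [hev] with t ht
    simpa [g] using hmin _ ht.le
  have hder : HasDerivAt g (∑ a, ∑ b, c a b * (Real.sin (2 * Real.pi *
      ((U b + h b) - (U a + h a))) / (2 * Real.pi) * (e b - e a))) 0 := by
    refine HasDerivAt.fun_sum fun a _ => HasDerivAt.fun_sum fun b _ => ?_
    refine HasDerivAt.const_mul _ ?_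
    have hlin : HasDerivAt (fun t : ℝ => (U b + (h b + t * e b)) - (U a + (h a + t * e a)))
        (e b - e a) 0 := by
      have hb := ((hasDerivAt_id (0 : ℝ)).mul_const (e b)).const_add (h b) |>.const_add (U b)
      have ha := ((hasDerivAt_id (0 : ℝ)).mul_const (e a)).const_add (h a) |>.const_add (U a)
      simpa using hb.fun_sub ha
    have := (hasDerivAt_potential ((U b + (h b + 0 * e b)) - (U a + (h a + 0 * e a)))).comp
      (0 : ℝ) hlin
    simpa [Function.comp_def] using this
  have h0 := hloc.hasDerivAt_eq_zero hder
  have hswap : ∀ a b : V, Real.sin (2 * Real.pi * ((U b + h b) - (U a + h a))) =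
      -Real.sin (2 * Real.pi * ((U a + h a) - (U b + h b))) := by
    intro a b
    rw [← Real.sin_neg]
    ring_nf
  have key : ∑ a, ∑ b, c a b * (Real.sin (2 * Real.pi *
      ((U b + h b) - (U a + h a))) / (2 * Real.pi) * (e b - e a)) =
      -(1 / Real.pi) * ∑ y, c x y * Real.sin (2 * Real.pi * ((U y + h y) - (U x + h x))) := by
    have hp : ∀ a b, c a b * (Real.sin (2 * Real.pi *
        ((U b + h b) - (U a + h a))) / (2 * Real.pi) * (e b - e a)) =
        (if b = x then c a b * (Real.sin (2 * Real.pi *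
          ((U b + h b) - (U a + h a))) / (2 * Real.pi)) else 0) -
        (if a = x then c a b * (Real.sin (2 * Real.pi *
          ((U b + h b) - (U a + h a))) / (2 * Real.pi)) else 0) := by
      intro a b
      simp only [e, Pi.single_apply]
      split_ifs <;> ring
    simp only [hp, Finset.sum_sub_distrib]
    rw [Finset.sum_comm (f := fun a b => if a = x then _ else _)]
    simp only [Finset.sum_ite_eq', Finset.mem_univ, if_true]
    rw [← Finset.sum_sub_distrib, Finset.mul_sum]
    refine Finset.sum_congr rfl fun y _ => ?_
    rw [hs y x, hswap y x]
    have := Real.pi_ne_zero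
    field_simp
    ring
  rw [key] at h0
  exact (mul_eq_zero.1 h0).resolve_left (by have := Real.pi_ne_zero; simp [this])

end FiniteGraph

/-! ### Comparing the two energies; existence of nearby steady states. -/

namespace Fractal

variable (P : Fractal d N)

theorem toK_isClosedEmbedding (n : ℕ) :
    Topology.IsClosedEmbedding (P.toK : P.V n → P.K) := by
  have : Continuous (P.toK : P.V n → P.K) := continuous_of_discreteTopology
  exact this.isClosedEmbedding fun x y h =>
    Subtype.ext (congrArg (fun p : P.K => (p : EuclideanSpace ℝ (Fin d))) h)

/-- A small perturbation on `V_n` extends to a small perturbation on `K`. -/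
theorem exists_extension {n : ℕ} {ε : ℝ} (hε : 0 < ε) {h : P.V n → ℝ} (hh : ∀ x, |h x| < ε) :
    ∃ g : C(P.K, ℝ), (∀ x, |g x| < ε) ∧ ∀ x, g (P.toK x) = h x := by
  obtain ⟨g, hg, hgh⟩ := ContinuousMap.exists_extension_forall_mem_of_isClosedEmbedding
    (⟨h, continuous_of_discreteTopology⟩ : C(P.V n, ℝ)) (t := Set.Ioo (-ε) ε)
    (fun x => abs_lt.1 (hh x)) ⟨0, by simpa using hε⟩ (P.toK_isClosedEmbedding n)
  exact ⟨g, fun x => abs_lt.2 (hg x), fun x => congrFun hgh x⟩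

end Fractal

namespace HarmonicStructure

variable {P : Fractal d N} {H : HarmonicStructure P}

theorem one_le_inv_prod_r (H : HarmonicStructure P) {l : ℕ} (w : Fin l → Fin N) :
    1 ≤ (∏ j, H.r (w j))⁻¹ :=
  (one_le_inv₀ (Finset.prod_pos fun _ _ => H.r_pos _)).2
    (Finset.prod_le_one (fun _ _ => (H.r_pos _).le) fun _ _ => (H.r_lt_one _).le)

namespace CycleBasis

variable {m : ℕ} (B : H.CycleBasis m)

/-- The Kuramoto energy on the fundamental domain. -/
def cutPhaseEnergy (k : ℕ) (f : B.FundDomain → ℝ) : ℝ :=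
  ∑ w : Fin (m + 1) → Fin N,
    (∏ j, H.r (w j))⁻¹ * phaseEnergy (H.c k) (fun x => f (B.cell w (P.toK x)))

theorem cutPhaseEnergy_le (k : ℕ) (f : B.FundDomain → ℝ) :
    B.cutPhaseEnergy k f ≤ B.cutEnergy k f :=
  Finset.sum_le_sum fun w _ =>
    mul_le_mul_of_nonneg_left (phaseEnergy_le (H.c_nonneg k) _) (H.inv_prod_r_pos w).le

theorem le_cutPhaseEnergy {k : ℕ} {f : B.FundDomain → ℝ} {η : ℝ} (hη : |η| ≤ 1 / 8)
    (hf : ∀ w (x y : P.V k), 0 < H.c k x y →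
      (f (B.cell w (P.toK y)) - f (B.cell w (P.toK x))) ^ 2 ≤ η ^ 2) :
    (1 - 5 * η ^ 2) * B.cutEnergy k f ≤ B.cutPhaseEnergy k f := by
  rw [cutEnergy, Finset.mul_sum]
  refine Finset.sum_le_sum fun w _ => ?_
  rw [mul_left_comm]
  exact mul_le_mul_of_nonneg_left (le_phaseEnergy (H.c_nonneg k) hη (hf w))
    (H.inv_prod_r_pos w).le

/-- On fine graphs, functions of bounded energy have short edges. -/
theorem sq_sub_le_of_cutEnergy_le {k : ℕ} {f : B.FundDomain → ℝ} {M s : ℝ} (hs : 0 ≤ s)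
    (hM : B.cutEnergy k f ≤ M)
    (hc : ∀ x y : P.V k, x ≠ y → 0 < H.c k x y → 2 * M ≤ s * H.c k x y)
    (w : Fin (m + 1) → Fin N) (x y : P.V k) (hxy : 0 < H.c k x y) :
    (f (B.cell w (P.toK y)) - f (B.cell w (P.toK x))) ^ 2 ≤ s := by
  by_cases hne : x = y
  · simpa [hne] using hs
  set D := f (B.cell w (P.toK y)) - f (B.cell w (P.toK x))
  have h1 : H.c k x y * (D ^ 2 / 2) ≤ M := by
    refine (energy_single_le (H.c_nonneg k) (fun x => f (B.cell w (P.toK x))) x y).trans ?_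
    refine le_trans ?_ hM
    refine le_trans ?_ (Finset.single_le_sum (f := fun w : Fin (m + 1) → Fin N =>
      (∏ j, H.r (w j))⁻¹ * energy (H.c k) (fun x => f (B.cell w (P.toK x))))
      (fun w _ => mul_nonneg (H.inv_prod_r_pos w).le (energy_nonneg (H.c_nonneg k) _))
      (Finset.mem_univ w))
    exact le_mul_of_one_le_left (energy_nonneg (H.c_nonneg k) _) (H.one_le_inv_prod_r w)
  have h2 := hc x y hne hxy
  have h3 : D ^ 2 * H.c k x y ≤ s * H.c k x y := by linarith
  exact le_of_mul_le_mul_right h3 hxy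

/-- The Kuramoto energy on `Γ_n` of a lift of the projection of `f + h`. -/
theorem phaseEnergy_eq_cutPhaseEnergy {f : B.FundDomain → ℝ} {u : C(P.K, UnitAddCircle)}
    (hu : ∀ p : B.FundDomain, u p.pt = (f p : UnitAddCircle))
    {U : EuclideanSpace ℝ (Fin d) → ℝ} (hU : ∀ x : P.K, (U x : UnitAddCircle) = u x)
    (k : ℕ) (h : EuclideanSpace ℝ (Fin d) → ℝ) :
    phaseEnergy (H.c (k + (m + 1))) (fun x => U x + h x) =
      B.cutPhaseEnergy k (fun p => f p + h p.pt) := by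
  -- The potential is 1-periodic, so it does not see the integer discrepancies between `U` and `f`
  -- at the cuts.
  refine (H.sum_c_add k (m + 1) (fun x y => potential ((U y + h y) - (U x + h x)))
    fun x => by rw [sub_self, potential_zero]).trans ?_
  refine Finset.sum_congr rfl fun w _ => congrArg _ (Finset.sum_congr rfl fun x _ =>
    Finset.sum_congr rfl fun y _ => congrArg _ (potential_eq_of_coe_eq ?_))
  have hcell : ∀ z : P.V k, (U (P.Fw w z) : UnitAddCircle) = (f (B.cell w (P.toK z)) : ℝ) := by
    intro z
    rw [← hu]
    exact hU (B.cell w (P.toK z)).pt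
  have hpt : ∀ z : P.V k, h (B.cell w (P.toK z)).pt = h (P.Fw w z) := fun z => rfl
  simp only [hpt, AddCircle.coe_sub, AddCircle.coe_add, hcell]

/-- A minimizer of the Kuramoto energy is a stable steady state if its edges are short. -/
theorem isStableSteadyState_of_minimizer {f : B.FundDomain → ℝ} {u : C(P.K, UnitAddCircle)}
    (hu : ∀ p : B.FundDomain, u p.pt = (f p : UnitAddCircle))
    {U : EuclideanSpace ℝ (Fin d) → ℝ} (hU : ∀ x : P.K, (U x : UnitAddCircle) = u x)
    {k : ℕ} {h : EuclideanSpace ℝ (Fin d) → ℝ}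
    (hcrit : ∀ x : P.V (k + (m + 1)), ∑ y : P.V (k + (m + 1)), H.c (k + (m + 1)) x y *
      Real.sin (2 * Real.pi * ((U y + h y) - (U x + h x))) = 0)
    (hshort : ∀ w (x y : P.V k), 0 < H.c k x y →
      |(f (B.cell w (P.toK y)) + h (P.Fw w y)) - (f (B.cell w (P.toK x)) + h (P.Fw w x))|
        ≤ 1 / 8) :
    H.IsStableSteadyState (k + (m + 1)) fun x => u (P.toK x) + (h x : UnitAddCircle) := by
  refine H.isStableSteadyState_of_short_edges (fun x => ?_) fun x y hxy hc => ?_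
  · rw [← hcrit x]
    refine Finset.sum_congr rfl fun y _ => ?_
    have hU' : ∀ z : P.V (k + (m + 1)), (U z : UnitAddCircle) = u (P.toK z) :=
      fun z => hU (P.toK z)
    rw [← sinTwoPi_coe, AddCircle.coe_sub, AddCircle.coe_add, AddCircle.coe_add, hU', hU']
  · obtain ⟨w, a, b, hab, hax, hby, -⟩ := H.exists_Fw_eq_of_c_pos k (m + 1) hxy hc
    have hval : ∀ (z : P.V k) (x : P.V (k + (m + 1))), P.Fw w z = x →
        ((f (B.cell w (P.toK z)) + h (P.Fw w z) : ℝ) : UnitAddCircle) =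
          u (P.toK x) + (h x : UnitAddCircle) := by
      intro z x hzx
      have hpt : (B.cell w (P.toK z)).pt = P.toK x := Subtype.ext hzx
      rw [AddCircle.coe_add, ← hu, hpt, hzx]
    refine ⟨_, ?_, hshort w a b hab⟩
    rw [AddCircle.coe_sub, hval a x hax, hval b y hby]

/-- A minimizer of the Kuramoto energy is close to the harmonic function. -/
theorem levelEnergy_le_of_minimizer {ρ : Fin B.b → ℤ} {v₁ : B.FundDomain} {f : B.FundDomain → ℝ}
    (hf : B.Admissible ρ v₁ f) {k : ℕ}
    (hmin : ∀ g, B.Admissible ρ v₁ g → B.cutEnergy k f ≤ B.cutEnergy k g)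
    {h : EuclideanSpace ℝ (Fin d) → ℝ} {η M : ℝ} (hη : |η| ≤ 1 / 8) (hM : B.cutEnergy k f ≤ M)
    (hle : B.cutPhaseEnergy k (fun p => f p + h p.pt) ≤ B.cutPhaseEnergy k f)
    (hshort : ∀ w (x y : P.V k), 0 < H.c k x y →
      ((f (B.cell w (P.toK y)) + h (P.Fw w y)) - (f (B.cell w (P.toK x)) + h (P.Fw w x))) ^ 2
        ≤ η ^ 2) :
    H.levelEnergy (k + (m + 1)) h ≤ 10 * η ^ 2 * M := by
  have h1 := B.le_cutPhaseEnergy (f := fun p => f p + h p.pt) hη hshort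
  rw [B.cutEnergy_add_of_minimal hf k hmin] at h1
  have h4 := (h1.trans hle).trans (B.cutPhaseEnergy_le k f)
  have he0 := H.levelEnergy_nonneg (k + (m + 1)) h
  generalize H.levelEnergy (k + (m + 1)) h = e at *
  generalize B.cutEnergy k f = e' at *
  -- Then 1 - 5η² ≥ 1/2, and (1 - 5η²)(e' + e) ≤ e' yields e ≤ 10η²M.
  have hη2 : η ^ 2 ≤ 1 / 64 := by
    have := abs_le.1 hη
    nlinarith
  have h5 : η ^ 2 * e' ≤ η ^ 2 * M := by gcongr
  have h6 : η ^ 2 * e ≤ 1 / 64 * e := by gcongr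
  nlinarith

/-- The constraint of energy at most one does double duty: it bounds E(f + h) by M + 1, which
shortens the edges, and the resulting bound 10η²M < 1 then shows that it is not active. -/
theorem exists_steadyState_of_level {ρ : Fin B.b → ℤ} {v₁ : B.FundDomain}
    {f : B.FundDomain → ℝ} (hf : B.Admissible ρ v₁ f) {k : ℕ}
    (hmin : ∀ g, B.Admissible ρ v₁ g → B.cutEnergy k f ≤ B.cutEnergy k g)
    {u : C(P.K, UnitAddCircle)} (hu : ∀ p : B.FundDomain, u p.pt = (f p : UnitAddCircle))
    {A η M : ℝ} (hA0 : 0 ≤ A)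
    (hA : ∀ (h : EuclideanSpace ℝ (Fin d) → ℝ), ∀ x ∈ P.V (k + (m + 1)),
      ∀ y ∈ P.V (k + (m + 1)), (h x - h y) ^ 2 ≤ A * H.levelEnergy (k + (m + 1)) h)
    (hη : |η| ≤ 1 / 8) (hM : B.cutEnergy k f ≤ M) (hηM : 10 * η ^ 2 * M < 1)
    (hc : ∀ x y : P.V k, x ≠ y → 0 < H.c k x y → 2 * (M + 1) ≤ η ^ 2 * H.c k x y) :
    ∃ h : P.V (k + (m + 1)) → ℝ, (∀ x, h x ^ 2 ≤ A * (10 * η ^ 2 * M)) ∧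
      H.IsStableSteadyState (k + (m + 1)) fun x => u (P.toK x) + (h x : UnitAddCircle) := by
  -- A pointwise lift; no continuity is needed, by periodicity.
  obtain ⟨U, hU⟩ : ∃ U : EuclideanSpace ℝ (Fin d) → ℝ,
      ∀ x : P.K, (U x : UnitAddCircle) = u x := by
    choose U' hU' using fun x : P.K => QuotientAddGroup.mk_surjective (u x)
    refine ⟨Function.extend Subtype.val U' 0, fun x => ?_⟩
    rw [Subtype.val_injective.extend_apply]
    exact hU' x
  obtain ⟨E, hE⟩ : ∃ E : (P.V (k + (m + 1)) → ℝ) → EuclideanSpace ℝ (Fin d) → ℝ,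
      ∀ h (x : P.V (k + (m + 1))), E h x = h x :=
    ⟨fun h => Function.extend Subtype.val h 0, fun h x => Subtype.val_injective.extend_apply _ _ _⟩
  have hEe : ∀ h, H.levelEnergy (k + (m + 1)) (E h) = energy (H.c (k + (m + 1))) h := fun h => by
    simp only [levelEnergy, hE]
  obtain ⟨o, ho⟩ := P.V_zero_nonempty
  have ho' : o ∈ P.V (k + (m + 1)) := P.V_mono (Nat.zero_le _) ho
  obtain ⟨h, hho, hh1, hhmin⟩ := exists_phaseEnergy_minimizer (H.c_nonneg (k + (m + 1)))
    (C := A) (fun h x y => by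
      have := hA (E h) x x.2 y y.2
      rwa [hE, hE, hEe] at this) (fun x => U x) ⟨o, ho'⟩
  have hle : B.cutPhaseEnergy k (fun p => f p + E h p.pt) ≤ B.cutPhaseEnergy k f := by
    have h1 := hhmin (fun _ => 0) (by simp [energy])
    have h2 := B.phaseEnergy_eq_cutPhaseEnergy hu hU k (E h)
    have h3 := B.phaseEnergy_eq_cutPhaseEnergy hu hU k fun _ => 0
    simp only [hE] at h2
    simp only [add_zero] at h1 h3
    rwa [h2, h3] at h1
  have hshort := B.sq_sub_le_of_cutEnergy_le (k := k) (f := fun p => f p + E h p.pt)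
    (sq_nonneg η) (M := M + 1) (by
      rw [B.cutEnergy_add_of_minimal hf k hmin, hEe]
      exact add_le_add hM hh1) hc
  have hen := B.levelEnergy_le_of_minimizer hf hmin hη hM hle hshort
  have hlt : energy (H.c (k + (m + 1))) h < 1 := by
    rw [← hEe]
    exact hen.trans_lt hηM
  refine ⟨h, fun x => ?_, ?_⟩
  · have h1 := hA (E h) x x.2 o ho'
    rw [hE, show E h o = 0 from (hE h ⟨o, ho'⟩).trans hho, sub_zero] at h1
    exact h1.trans (mul_le_mul_of_nonneg_left hen hA0)
  · have := B.isStableSteadyState_of_minimizer hu hU (k := k) (h := E h) (fun x => by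
      simp only [hE]
      exact sum_sin_eq_zero_of_minimizer (H.c_symm _) hlt hhmin x)
      (fun w x y hxy => (sq_le_sq.1 (hshort w x y hxy)).trans hη)
    simpa only [hE] using this

/-- Steady states of the Kuramoto model close to the projection of a harmonic function. -/
theorem exists_steadyState_near {ρ : Fin B.b → ℤ} {v₁ : B.FundDomain} {f : B.FundDomain → ℝ}
    (hf : B.Admissible ρ v₁ f)
    (hmin : ∀ k g, B.Admissible ρ v₁ g → B.cutEnergy k f ≤ B.cutEnergy k g)
    {u : C(P.K, UnitAddCircle)} (hu : ∀ p : B.FundDomain, u p.pt = (f p : UnitAddCircle))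
    {ε : ℝ} (hε : 0 < ε) :
    ∃ n₀ : ℕ, ∀ n ≥ n₀, ∃ h : P.V n → ℝ, (∀ x, |h x| < ε) ∧
      H.IsStableSteadyState n fun x => u (P.toK x) + (h x : UnitAddCircle) := by
  obtain ⟨A, hA0, hA⟩ := H.exists_sq_sub_le_levelEnergy
  obtain ⟨κ, q, hκ, hq0, hq1, hcq⟩ := H.exists_le_pow_mul_c
  obtain ⟨M, hM0, hfM⟩ : ∃ M, 0 ≤ M ∧ ∀ k, B.cutEnergy k f ≤ M :=
    ⟨_, B.cutEnergy_nonneg 0 f, B.cutEnergy_le_zero hf hmin⟩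
  obtain ⟨η, hη0, hη8, hη1, hηε⟩ : ∃ η : ℝ, 0 < η ∧ |η| ≤ 1 / 8 ∧ 10 * η ^ 2 * M < 1 ∧
      A * (10 * η ^ 2 * M) < ε ^ 2 := by
    have hev : ∀ᶠ η : ℝ in nhds 0, |η| < 1 / 8 ∧ 10 * η ^ 2 * M < 1 ∧
        A * (10 * η ^ 2 * M) < ε ^ 2 := by
      have hlt : ∀ {g : ℝ → ℝ} {c : ℝ}, Continuous g → g 0 < c → ∀ᶠ η in nhds 0, g η < c :=
        fun hg h => hg.continuousAt.eventually_lt_const h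
      exact (hlt (by fun_prop) (by simp)).and ((hlt (by fun_prop) (by simp)).and
        (hlt (by fun_prop) (by simpa using pow_pos hε 2)))
    obtain ⟨η, ⟨h1, h2, h3⟩, h0⟩ :=
      ((hev.filter_mono nhdsWithin_le_nhds).and (self_mem_nhdsWithin (s := Set.Ioi (0 : ℝ)))).exists
    exact ⟨η, h0, h1.le, h2, h3⟩
  -- With η fixed, conductances of order κq⁻ᵏ eventually exceed 2(M + 1)/η².
  obtain ⟨k₀, hk₀⟩ := exists_pow_lt_of_lt_one
    (show 0 < κ * η ^ 2 / (2 * (M + 1)) by positivity) hq1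
  refine ⟨k₀ + (m + 1), fun n hn => ?_⟩
  obtain ⟨k, rfl⟩ : ∃ k, n = k + (m + 1) := ⟨n - (m + 1), by omega⟩
  have hk : k₀ ≤ k := by omega
  have hcM : ∀ x y : P.V k, x ≠ y → 0 < H.c k x y → 2 * (M + 1) ≤ η ^ 2 * H.c k x y := by
    intro x y hxy hc
    have h1 : q ^ k ≤ κ * η ^ 2 / (2 * (M + 1)) :=
      (pow_le_pow_of_le_one hq0.le hq1.le hk).trans hk₀.le
    have h2 : κ ≤ κ * η ^ 2 / (2 * (M + 1)) * H.c k x y :=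
      (hcq k x y hxy hc).trans (mul_le_mul_of_nonneg_right h1 hc.le)
    rw [div_mul_eq_mul_div, le_div_iff₀ (by positivity), mul_assoc] at h2
    exact le_of_mul_le_mul_left h2 hκ
  obtain ⟨h, hh, hst⟩ := B.exists_steadyState_of_level hf (hmin k) hu hA0 (hA _) hη8 (hfM k)
    hη1 hcM
  exact ⟨h, fun x => abs_lt_of_sq_lt_sq ((hh x).trans_lt hηε) hε.le, hst⟩

end CycleBasis

end HarmonicStructure

end PCF

end

theorem mainTheorem2 {d N : ℕ} (P : PCF.Fractal d N) (H : PCF.HarmonicStructure P) (m : ℕ)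
    (B : H.CycleBasis m) (ρ : Fin B.b → ℤ)
    (v₁ : B.FundDomain) (hv₁ : (v₁.pt : EuclideanSpace ℝ (Fin d)) ∈ P.V 0)
    (u : C(P.K, UnitAddCircle)) (hu : B.IsHarmonicMap ρ v₁ u) :
    B.HasDegreeVector u ρ ∧
    ∀ ε : ℝ, 0 < ε → ∃ n₀ : ℕ, ∀ n ≥ n₀,
      ∃ un : P.V n → UnitAddCircle,
        H.IsStableSteadyState n un ∧
        (∀ x : P.V n, ‖un x - u (P.toK x)‖ < ε) ∧
        ∃ ext : C(P.K, UnitAddCircle),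
          (∀ x : P.V n, ext (P.toK x) = un x) ∧
          B.HasDegreeVector ext ρ ∧
          ∀ x : P.K, ‖ext x - u x‖ < ε := by
  obtain ⟨f, hfc, hf, hmin, hfu⟩ := hu
  have hdeg := B.hasDegreeVector_of_isHarmonicMap hfc hf.2 hfu
  refine ⟨hdeg, fun ε hε => ?_⟩
  obtain ⟨n₀, hn₀⟩ := B.exists_steadyState_near hf hmin hfu hε
  refine ⟨n₀, fun n hn => ?_⟩
  obtain ⟨h, hhε, hst⟩ := hn₀ n hn
  obtain ⟨g, hgε, hgh⟩ := P.exists_extension hε hhε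
  refine ⟨_, hst, fun x => ?_, u + ⟨fun x => (g x : UnitAddCircle),
    (AddCircle.continuous_mk' 1).comp g.continuous⟩, fun x => ?_, fun i => ?_, fun x => ?_⟩
  · rw [add_sub_cancel_left]
    exact (PCF.norm_coe_le_abs _).trans_lt (hhε x)
  · rw [← hgh]
    rfl
  · exact (hdeg i).of_sub_eq_coe g fun x => rfl
  · rw [ContinuousMap.add_apply, add_sub_cancel_left]
    exact (PCF.norm_coe_le_abs _).trans_lt (hgε x)
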